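/- There is an absolute constant $C>0$ such that the following holds for all integers $d\ge 1$, $n\ge 1$ and every real $\beta$. Let $X_1,\dots,X_n$ be independent random vectors in $\mathbb{R}^d$ with $\mathbb{E}X_i=0$ and $|X_i|\le\beta$ almost surely for each $i$, where $|\cdot|$ is the Euclidean norm, and suppose that $W=\frac{1}{\sqrt n}\sum_{i=1}^n X_i$ satisfies $\mathbb{E}[WW^{\mathrm T}]=I_d$. Let $Z$ have the standard $d$-dimensional normal distribution, and let $$d_{\mathcal W}(\mathcal L(W),\mathcal L(Z))=\sup_h|\mathbb{E}h(W)-\mathbb{E}h(Z)|,$$ the supremum being over all $h:\mathbb{R}^d\to\mathbb{R}$ with $|h(x)-h(y)|\le|x-y|$ for all $x,y\in\mathbb{R}^d$, be the Wasserstein distance. Then $$d_{\mathcal W}(\mathcal L(W),\mathcal L(Z))\le\frac{Cd\beta}{\sqrt n}(1+\log n)\qquad\text{and}\qquad d_{\mathcal W}(\mathcal L(W),\mathcal L(Z))\le\frac{Cd^2\beta}{\sqrt n}.$$ -/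

import Mathlib

open MeasureTheory ProbabilityTheory
open scoped ENNReal

/-- The Wasserstein distance between two laws on `ℝ^d`: the supremum of `|∫ h dμ - ∫ h dν|` over all
functions `h : ℝ^d → ℝ` that are Lipschitz with constant `1` for the Euclidean metric. It is
`[0, ∞]`-valued, so the supremum has its true value even where it is infinite. It is meant for laws
with finite first moment, for which every such `h` is integrable. -/
noncomputable def wassersteinDist {d : ℕ} (μ ν : Measure (EuclideanSpace ℝ (Fin d))) : ℝ≥0∞ :=
  ⨆ (h : EuclideanSpace ℝ (Fin d) → ℝ) (_ : LipschitzWith 1 h),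
    ENNReal.ofReal |∫ x, h x ∂μ - ∫ x, h x ∂ν|

/-- The normalized sum `W = n^{-1/2} ∑ X_i` of `n` random vectors. -/
noncomputable def normalizedSum {Ω : Type*} {d n : ℕ}
    (X : Fin n → Ω → EuclideanSpace ℝ (Fin d)) (ω : Ω) : EuclideanSpace ℝ (Fin d) :=
  (√(n : ℝ))⁻¹ • ∑ i, X i ω

/-- The matrix `E[W Wᵀ]` of second moments of a random vector `W`. -/
noncomputable def secondMomentMatrix {Ω : Type*} [MeasurableSpace Ω] {d : ℕ} (P : Measure Ω)
    (W : Ω → EuclideanSpace ℝ (Fin d)) : Matrix (Fin d) (Fin d) ℝ :=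
  Matrix.of fun j k => ∫ ω, W ω j * W ω k ∂P

/-! Write `W = ∑ ξ_i` with `ξ_i = X_i / √n` and `‖ξ_i‖ ≤ B = β / √n`, and move from `W` to an
independent Gaussian `Z` along `Φ(t) = E h(cos t W + sin t Z)`, `0 ≤ t ≤ π/2`. Put `a = cos t`, `b =
sin t`. In `Φ'` the Gaussian is integrated out: the `W` term becomes a sum of first derivatives of
the smoothing of `h` at scale `b` in the directions `ξ_i`. Since the covariances of the `ξ_i` add up
to the identity, integration by parts turns the `Z` term into a sum of second derivatives in the
directions of independent copies of the `ξ_i`. With `W = R_i + ξ_i`, a Taylor expansion at `a R_i`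
cancels the leading terms (centring kills the first), so `|Φ'| ≤ 2 K a² b B d`, where `K` is a
Lipschitz constant of the second derivative averaged over `R_i` (`exists_hasDerivAt_interpolation`).

Stopping at `sin t = s` costs at most `2 √d s`; the rest depends on `K`. Pointwise, `K = 2 / b²`, so
`|Φ'|` is of order `B d / b` and integrates to `B d log (1/s)`; `s = 1/√n` gives the logarithmic
bound.

For the other bound, averaging over `R_i` is used as extra smoothing. Replace `R_i` by `W`, then `W`
by `Z`, at a cost proportional to `B + δ`, where `δ` is the Wasserstein distance itself. At `a Z`
the smoothing is completed to scale `1`, and no singularity remains. Hence `K = 2 + 6 a (B + δ) /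
b³`, and integration yields `δ ≤ 2 √d s + B d (4 + 12 (B + δ) / s)`. With `s = 24 B d` the right
side contains only `δ / 2`, which is absorbed. Test functions are taken `C¹` throughout and
mollification reaches all Lipschitz ones. -/

/-! ### Standard Gaussian: density, integration by parts, moments, rotation invariance. -/

section Gaussian

open scoped RealInnerProductSpace

variable {E : Type*} [NormedAddCommGroup E] [InnerProductSpace ℝ E] [FiniteDimensional ℝ E]
  [MeasurableSpace E] [BorelSpace E]

/-- The standard Gaussian measure has density `(2π)^(-d/2) exp (-‖z‖²/2)`. -/
theorem stdGaussian_eq_withDensity :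
    stdGaussian E = volume.withDensity (fun z : E => ENNReal.ofReal
      (((2 * Real.pi) ^ (Module.finrank ℝ E / 2 : ℝ))⁻¹ * Real.exp (-(1 / 2) * ‖z‖ ^ 2))) := by
  set c : ℝ := ((2 * Real.pi) ^ (Module.finrank ℝ E / 2 : ℝ))⁻¹ with hc
  have hcpos : 0 < (2 * Real.pi) ^ (Module.finrank ℝ E / 2 : ℝ) := by positivity
  have hint : Integrable (fun z : E => c * Real.exp (-(1 / 2) * ‖z‖ ^ 2)) := by
    refine Integrable.const_mul (Integrable.of_integral_ne_zero ?_) _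
    rw [GaussianFourier.integral_rexp_neg_mul_sq_norm (by norm_num)]
    positivity
  have hfin : IsFiniteMeasure (volume.withDensity (fun z : E => ENNReal.ofReal
      (c * Real.exp (-(1 / 2) * ‖z‖ ^ 2)))) :=
    isFiniteMeasure_withDensity_ofReal hint.2
  refine Measure.ext_of_charFun ?_
  ext t
  rw [charFun_stdGaussian, charFun_apply, integral_withDensity_eq_integral_toReal_smul
    (by fun_prop) (by simp)]
  have h1 : ∀ x : E, (ENNReal.ofReal (c * Real.exp (-(1 / 2) * ‖x‖ ^ 2))).toReal •
      Complex.exp (⟪x, t⟫ * Complex.I) =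
      (c : ℂ) * Complex.exp (-(1 / 2 : ℂ) * ‖x‖ ^ 2 + Complex.I * ⟪t, x⟫) := by
    intro x
    rw [ENNReal.toReal_ofReal (by positivity), Complex.real_smul, Complex.exp_add,
      real_inner_comm]
    push_cast
    ring_nf
  simp_rw [h1]
  rw [integral_const_mul, GaussianFourier.integral_cexp_neg_mul_sq_norm_add (by norm_num)]
  have h2 : ((Real.pi : ℂ) / (1 / 2)) ^ (Module.finrank ℝ E / 2 : ℂ)
      = (((2 * Real.pi) ^ (Module.finrank ℝ E / 2 : ℝ) : ℝ) : ℂ) := by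
    rw [Complex.ofReal_cpow (by positivity)]
    push_cast
    congr 1
    ring
  rw [h2, ← mul_assoc, ← Complex.ofReal_mul, hc, inv_mul_cancel₀ hcpos.ne', Complex.ofReal_one,
    one_mul, Complex.I_sq]
  congr 1
  ring

theorem integral_mul_hasFDerivAt_eq_neg {f g : E → ℝ} {f' g' : E → E →L[ℝ] ℝ} {v : E}
    (hf : ∀ x, HasFDerivAt f (f' x) x) (hg : ∀ x, HasFDerivAt g (g' x) x)
    (h1 : Integrable (fun x => f' x v * g x)) (h2 : Integrable (fun x => f x * g' x v))
    (h3 : Integrable (fun x => f x * g x)) :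
    ∫ x, f x * g' x v = - ∫ x, f' x v * g x :=
  integral_bilinear_hasFDerivAt_right_eq_neg_left_of_integrable
    (B := ContinuousLinearMap.mul ℝ ℝ) h1 h2 h3 (fun x _ => hf x) (fun x _ => hg x)

/-- Gaussian integration by parts. -/
theorem integral_fderiv_stdGaussian {g : E → ℝ} {g' : E → E →L[ℝ] ℝ} {v : E}
    (hg : ∀ x, HasFDerivAt g (g' x) x) (hi : Integrable g (stdGaussian E))
    (hi' : Integrable (fun z => g' z v) (stdGaussian E))
    (hiv : Integrable (fun z => g z * ⟪v, z⟫) (stdGaussian E)) :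
    ∫ z, g' z v ∂(stdGaussian E) = ∫ z, g z * ⟪v, z⟫ ∂(stdGaussian E) := by
  rw [stdGaussian_eq_withDensity] at *
  set c : ℝ := ((2 * Real.pi) ^ (Module.finrank ℝ E / 2 : ℝ))⁻¹ with hc
  have hcpos : 0 < c := by positivity
  clear_value c
  have hden : ∀ z : E, (ENNReal.ofReal (c * Real.exp (-(1 / 2) * ‖z‖ ^ 2))).toReal =
      c * Real.exp (-(1 / 2) * ‖z‖ ^ 2) := fun z => ENNReal.toReal_ofReal (by positivity)
  rw [integrable_withDensity_iff_integrable_smul' (by fun_prop) (by simp)] at hi hi' hiv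
  rw [integral_withDensity_eq_integral_toReal_smul (by fun_prop) (by simp),
    integral_withDensity_eq_integral_toReal_smul (by fun_prop) (by simp)]
  simp_rw [hden, smul_eq_mul] at hi hi' hiv ⊢
  have hf : ∀ x : E, HasFDerivAt (fun z : E => c * Real.exp (-(1 / 2) * ‖z‖ ^ 2))
      (-(c * Real.exp (-(1 / 2) * ‖x‖ ^ 2)) • innerSL ℝ x) x := by
    intro x
    have h1 : HasFDerivAt (fun z : E => ‖z‖ ^ 2) (2 • innerSL ℝ x) x :=
      (hasStrictFDerivAt_norm_sq x).hasFDerivAt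
    have h2 := ((h1.const_mul (-(1 / 2) : ℝ)).exp).const_mul c
    refine h2.congr_fderiv ?_
    ext y
    simp only [smul_apply, innerSL_apply_apply, smul_eq_mul, nsmul_eq_mul]
    push_cast
    ring
  have h3 : Integrable (fun x : E => (-(c * Real.exp (-(1 / 2) * ‖x‖ ^ 2)) • innerSL ℝ x) v * g x) := by
    refine hiv.neg.congr (.of_forall fun x => ?_)
    simp only [Pi.neg_apply, smul_apply, innerSL_apply_apply, smul_eq_mul, real_inner_comm]
    ring
  have key := integral_mul_hasFDerivAt_eq_neg hf hg h3 hi' hi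
  rw [key, ← integral_neg]
  congr 1
  ext x
  simp only [smul_apply, innerSL_apply_apply, smul_eq_mul, real_inner_comm]
  ring

theorem integrable_one_add_norm_pow_stdGaussian (k : ℕ) :
    Integrable (fun z : E => (1 + ‖z‖) ^ k) (stdGaussian E) := by
  have h0 : MemLp (fun z : E => ‖id z‖) k (stdGaussian E) :=
    (IsGaussian.memLp_id (stdGaussian E) k (by simp)).norm
  have h1 : MemLp (fun _ : E => (1 : ℝ)) k (stdGaussian E) := memLp_const 1
  have h : MemLp (fun z : E => 1 + ‖z‖) k (stdGaussian E) := h1.add h0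
  have := h.integrable_norm_pow'
  refine this.congr (Filter.Eventually.of_forall fun z => ?_)
  simp only [Real.norm_eq_abs]
  rw [abs_of_nonneg (by positivity)]

/-- Functions of polynomial growth are integrable for the standard Gaussian measure. -/
theorem integrable_stdGaussian_of_growth {F : Type*} [NormedAddCommGroup F]
    {f : E → F} (hf : AEStronglyMeasurable f (stdGaussian E)) (K : ℝ) (k : ℕ)
    (hb : ∀ z, ‖f z‖ ≤ K * (1 + ‖z‖) ^ k) : Integrable f (stdGaussian E) :=
  ((integrable_one_add_norm_pow_stdGaussian k).const_mul K).mono' hf (.of_forall hb)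

theorem integral_inner_mul_inner_stdGaussian (u v : E) :
    ∫ z, ⟪u, z⟫ * ⟪v, z⟫ ∂(stdGaussian E) = ⟪u, v⟫ := by
  have h := covarianceBilin_apply_eq_cov (μ := stdGaussian E) IsGaussian.memLp_two_id u v
  rw [covarianceBilin_stdGaussian, covariance_eq_sub] at h
  · have h0 : ∀ w : E, ∫ z, ⟪w, z⟫ ∂(stdGaussian E) = 0 := fun w =>
      integral_strongDual_stdGaussian (innerSL ℝ w)
    exact (by simp only [h0, Pi.mul_apply] at h; linarith : _ = innerSL ℝ u v)
  all_goals exact IsGaussian.memLp_dual (stdGaussian E) (innerSL ℝ _) 2 (by simp)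

theorem integral_inner_sq_stdGaussian (v : E) :
    ∫ z, ⟪v, z⟫ ^ 2 ∂(stdGaussian E) = ‖v‖ ^ 2 := by
  simp_rw [pow_two, integral_inner_mul_inner_stdGaussian, real_inner_self_eq_norm_mul_norm]

theorem integrable_inner_sq_stdGaussian (v : E) :
    Integrable (fun z => ⟪v, z⟫ ^ 2) (stdGaussian E) :=
  integrable_stdGaussian_of_growth (by fun_prop) (‖v‖ ^ 2) 2 fun z => by
    rw [norm_pow, ← mul_pow]
    gcongr
    exact (norm_inner_le_norm v z).trans (by gcongr; linarith)

/-- Cauchy–Schwarz, in the form that the variance of `|⟪v, z⟫|` is nonnegative. -/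
theorem integral_abs_inner_stdGaussian_le (v : E) :
    ∫ z, |⟪v, z⟫| ∂(stdGaussian E) ≤ ‖v‖ := by
  have hi : Integrable (fun z => |⟪v, z⟫|) (stdGaussian E) :=
    (IsGaussian.integrable_dual (stdGaussian E) (innerSL ℝ v)).abs
  have h := variance_nonneg (fun z => |⟪v, z⟫|) (stdGaussian E)
  rw [variance_eq_sub] at h
  · simp only [Pi.pow_apply, sq_abs, integral_inner_sq_stdGaussian] at h
    exact abs_le_of_sq_le_sq' (by linarith) (norm_nonneg v) |>.2
  · exact (IsGaussian.memLp_dual (stdGaussian E) (innerSL ℝ v) 2 (by simp)).abs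

theorem integral_norm_sq_stdGaussian :
    ∫ z, ‖z‖ ^ 2 ∂(stdGaussian E) = Module.finrank ℝ E := by
  simp_rw [← (stdOrthonormalBasis ℝ E).sum_sq_inner_right]
  rw [integral_finsetSum _ fun i _ => integrable_inner_sq_stdGaussian _]
  simp [integral_inner_sq_stdGaussian]

theorem integral_norm_stdGaussian_le :
    ∫ z, ‖z‖ ∂(stdGaussian E) ≤ √(Module.finrank ℝ E) := by
  have h := variance_nonneg (fun z => ‖id z‖) (stdGaussian E)
  rw [variance_eq_sub (IsGaussian.memLp_two_id (μ := stdGaussian E)).norm] at h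
  simp only [Pi.pow_apply, id, integral_norm_sq_stdGaussian] at h
  exact Real.le_sqrt_of_sq_le (by linarith)

/-- A pair of independent standard Gaussian vectors is invariant under rotations. -/
theorem integral_rotation_stdGaussian {F : Type*} [NormedAddCommGroup F] [NormedSpace ℝ F]
    (f : E × E → F) (hf : Continuous f) (θ : ℝ) :
    ∫ p : E × E, f (Real.cos θ • p.1 + Real.sin θ • p.2, -Real.sin θ • p.1 + Real.cos θ • p.2)
      ∂((stdGaussian E).prod (stdGaussian E)) =
    ∫ p, f p ∂((stdGaussian E).prod (stdGaussian E)) := by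
  conv_rhs => rw [← IsGaussian.map_rotation_eq_self (μ := stdGaussian E)
    integral_id_stdGaussian θ]
  rw [integral_map (by fun_prop) hf.aestronglyMeasurable]
  simp [ContinuousLinearMap.rotation_apply]

end Gaussian

/-! ### Gaussian smoothing and its second derivative as an integral kernel. -/

section Smoothing

open scoped RealInnerProductSpace

set_option linter.unusedSectionVars false

variable {E : Type*} [NormedAddCommGroup E] [InnerProductSpace ℝ E] [FiniteDimensional ℝ E]
  [MeasurableSpace E] [BorelSpace E]

/-- A continuous function that grows at most linearly. -/
def LinearGrowth (h : E → ℝ) : Prop :=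
  Continuous h ∧ ∃ K, ∀ x, |h x| ≤ K * (1 + ‖x‖)

/-- The average of `h` over a Gaussian of standard deviation `s` centred at `x`. -/
noncomputable def gaussSmooth (s : ℝ) (h : E → ℝ) (x : E) : ℝ :=
  ∫ z, h (x + s • z) ∂(stdGaussian E)

/-- The second derivative in direction `v` of `gaussSmooth s h`, expressed without derivatives
of `h`. -/
noncomputable def gaussHess (s : ℝ) (v : E) (h : E → ℝ) (x : E) : ℝ :=
  (s ^ 2)⁻¹ * ∫ z, h (x + s • z) * (⟪v, z⟫ ^ 2 - ‖v‖ ^ 2) ∂(stdGaussian E)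

theorem LinearGrowth.of_lipschitz {h : E → ℝ} {L : ℝ} (hL : 0 ≤ L)
    (hh : ∀ x y, |h x - h y| ≤ L * ‖x - y‖) : LinearGrowth h := by
  refine ⟨(LipschitzWith.of_dist_le_mul (K := ⟨L, hL⟩) fun x y => ?_).continuous,
    |h 0| + L, fun x => ?_⟩
  · rw [Real.dist_eq, dist_eq_norm]
    exact hh x y
  · have h1 := hh x 0
    have h2 := abs_add_le (h x - h 0) (h 0)
    rw [sub_add_cancel] at h2
    rw [sub_zero] at h1
    nlinarith [norm_nonneg x, abs_nonneg (h 0), mul_nonneg (abs_nonneg (h 0)) (norm_nonneg x)]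

theorem LinearGrowth.exists_bound_affine {h : E → ℝ} (hh : LinearGrowth h) (x : E) (s : ℝ) :
    ∃ K, 0 ≤ K ∧ ∀ z, |h (x + s • z)| ≤ K * (1 + ‖z‖) := by
  obtain ⟨K, hK⟩ := hh.2
  have hK0 : 0 ≤ K := by simpa using (abs_nonneg _).trans (hK 0)
  refine ⟨K * (1 + ‖x‖ + |s|), by positivity, fun z => (hK _).trans ?_⟩
  rw [mul_assoc]
  gcongr
  have h1 := norm_add_le x (s • z)
  rw [norm_smul, Real.norm_eq_abs] at h1
  nlinarith [norm_nonneg x, norm_nonneg z, abs_nonneg s, mul_nonneg (norm_nonneg x) (norm_nonneg z)]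

theorem LinearGrowth.integrable_mul {h : E → ℝ} (hh : LinearGrowth h) (x : E) (s : ℝ)
    {w : E → ℝ} (hw : Continuous w) {A : ℝ} {k : ℕ} (hA : ∀ z, |w z| ≤ A * (1 + ‖z‖) ^ k) :
    Integrable (fun z => h (x + s • z) * w z) (stdGaussian E) := by
  obtain ⟨K, hK0, hK⟩ := hh.exists_bound_affine x s
  have hc := hh.1
  refine integrable_stdGaussian_of_growth (by fun_prop) (K * A) (k + 1) fun z => ?_
  rw [Real.norm_eq_abs, abs_mul]
  calc |h (x + s • z)| * |w z| ≤ (K * (1 + ‖z‖)) * (A * (1 + ‖z‖) ^ k) := by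
        gcongr
        exacts [hK z, hA z]
    _ = K * A * (1 + ‖z‖) ^ (k + 1) := by ring

theorem LinearGrowth.integrable {h : E → ℝ} (hh : LinearGrowth h) (x : E) (s : ℝ) :
    Integrable (fun z => h (x + s • z)) (stdGaussian E) := by
  simpa using hh.integrable_mul x s (w := fun _ => 1) (by fun_prop) (A := 1) (k := 0) (by simp)

theorem abs_inner_le_growth (v z : E) : |⟪v, z⟫| ≤ ‖v‖ * (1 + ‖z‖) ^ 1 := by
  have h1 := abs_real_inner_le_norm v z
  have h2 := norm_nonneg v
  rw [pow_one]
  nlinarith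

theorem abs_hermite_le (v z : E) : |⟪v, z⟫ ^ 2 - ‖v‖ ^ 2| ≤ ‖v‖ ^ 2 * (1 + ‖z‖) ^ 2 := by
  have h1 : ⟪v, z⟫ ^ 2 ≤ (‖v‖ * ‖z‖) ^ 2 := by
    rw [← sq_abs]
    gcongr
    exact abs_real_inner_le_norm v z
  have h2 := sq_nonneg ⟪v, z⟫
  rw [abs_le]
  constructor <;> nlinarith [sq_nonneg ‖v‖, norm_nonneg z,
    mul_nonneg (sq_nonneg ‖v‖) (norm_nonneg z), mul_nonneg (sq_nonneg ‖v‖) (sq_nonneg ‖z‖)]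

theorem LinearGrowth.integrable_mul_inner {h : E → ℝ} (hh : LinearGrowth h) (x v : E) (s : ℝ) :
    Integrable (fun z => h (x + s • z) * ⟪v, z⟫) (stdGaussian E) :=
  hh.integrable_mul x s (by fun_prop) (abs_inner_le_growth v)

theorem LinearGrowth.integrable_mul_hermite {h : E → ℝ} (hh : LinearGrowth h) (x v : E) (s : ℝ) :
    Integrable (fun z => h (x + s • z) * (⟪v, z⟫ ^ 2 - ‖v‖ ^ 2)) (stdGaussian E) :=
  hh.integrable_mul x s (by fun_prop) (abs_hermite_le v)

theorem integrable_hermite (v : E) :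
    Integrable (fun z => ⟪v, z⟫ ^ 2 - ‖v‖ ^ 2) (stdGaussian E) :=
  (integrable_inner_sq_stdGaussian v).sub (integrable_const _)

theorem integral_abs_hermite_le (v : E) :
    ∫ z, |⟪v, z⟫ ^ 2 - ‖v‖ ^ 2| ∂(stdGaussian E) ≤ 2 * ‖v‖ ^ 2 := by
  calc ∫ z, |⟪v, z⟫ ^ 2 - ‖v‖ ^ 2| ∂(stdGaussian E)
      ≤ ∫ z, (⟪v, z⟫ ^ 2 + ‖v‖ ^ 2) ∂(stdGaussian E) := by
        refine integral_mono (integrable_hermite v).abs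
          ((integrable_inner_sq_stdGaussian v).add (integrable_const _)) fun z => ?_
        rw [abs_le]
        constructor <;> nlinarith [sq_nonneg ‖v‖, sq_nonneg ⟪v, z⟫]
    _ = 2 * ‖v‖ ^ 2 := by
        rw [integral_add (integrable_inner_sq_stdGaussian v) (integrable_const _),
          integral_inner_sq_stdGaussian]
        simp
        ring

theorem abs_integral_mul_le_of_abs_le {h w : E → ℝ} {M : ℝ} (hM : ∀ x, |h x| ≤ M)
    (hw : Integrable w (stdGaussian E)) :
    |∫ z, h z * w z ∂(stdGaussian E)| ≤ M * ∫ z, |w z| ∂(stdGaussian E) := by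
  rw [← integral_const_mul]
  refine norm_integral_le_of_norm_le (f := fun z => h z * w z) (hw.abs.const_mul M) (.of_forall fun z => ?_)
  rw [Real.norm_eq_abs, abs_mul]
  gcongr
  exact hM z

/-- Only the `L¹` norm of the Hermite kernel enters, so no regularity of `h` is needed. -/
theorem abs_gaussHess_le {h : E → ℝ} {M : ℝ} (hM : ∀ x, |h x| ≤ M) (s : ℝ) (v x : E) :
    |gaussHess s v h x| ≤ 2 * M * ‖v‖ ^ 2 / s ^ 2 := by
  have hM0 : 0 ≤ M := (abs_nonneg _).trans (hM 0)
  have h1 := abs_integral_mul_le_of_abs_le (h := fun z => h (x + s • z)) (fun z => hM _)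
    (integrable_hermite v)
  have h2 := mul_le_mul_of_nonneg_left (integral_abs_hermite_le v) hM0
  rw [gaussHess, abs_mul, abs_of_nonneg (by positivity : (0 : ℝ) ≤ (s ^ 2)⁻¹), div_eq_inv_mul]
  gcongr
  linarith

theorem gaussHess_add_sub {h : E → ℝ} (hh : LinearGrowth h) (s : ℝ) (v x w : E) :
    gaussHess s v h (x + w) - gaussHess s v h x = gaussHess s v (fun y => h (y + w) - h y) x := by
  simp only [gaussHess]
  rw [← mul_sub, ← integral_sub (hh.integrable_mul_hermite _ _ _)
    (hh.integrable_mul_hermite _ _ _)]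
  congr 2
  ext z
  rw [add_right_comm]
  ring

/-- By linearity an increment of the second derivative is the second derivative of the increment `h
(· + w) - h`, which is bounded by `L * ‖w‖`; the sup-norm bound applies to it. -/
theorem abs_gaussHess_sub_le {h : E → ℝ} {L : ℝ} (hL : 0 ≤ L)
    (hh : ∀ x y, |h x - h y| ≤ L * ‖x - y‖) (s : ℝ) (v x y : E) :
    |gaussHess s v h x - gaussHess s v h y| ≤ 2 * L * ‖v‖ ^ 2 / s ^ 2 * ‖x - y‖ := by
  have h1 := gaussHess_add_sub (LinearGrowth.of_lipschitz hL hh) s v y (x - y)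
  rw [add_sub_cancel] at h1
  rw [h1]
  refine (abs_gaussHess_le (M := L * ‖x - y‖) (fun z => ?_) s v y).trans (le_of_eq (by ring))
  simpa using hh (z + (x - y)) z

theorem LinearGrowth.integrable_prod {h : E → ℝ} (hh : LinearGrowth h) (x : E) (s t : ℝ)
    {w : E → ℝ} (hw : Continuous w) {A : ℝ} {k : ℕ} (hA : ∀ z, |w z| ≤ A * (1 + ‖z‖) ^ k) :
    Integrable (fun p : E × E => h (x + s • p.1 + t • p.2) * w p.1)
      ((stdGaussian E).prod (stdGaussian E)) := by
  obtain ⟨K, hK⟩ := hh.2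
  have hK0 : 0 ≤ K := by simpa using (abs_nonneg _).trans (hK 0)
  have hA0 : 0 ≤ A := by simpa using (abs_nonneg _).trans (hA 0)
  have hc := hh.1
  have hi := ((integrable_one_add_norm_pow_stdGaussian (E := E) (k + 1)).mul_prod
    (integrable_one_add_norm_pow_stdGaussian (E := E) 1)).const_mul (K * (1 + ‖x‖ + |s| + |t|) * A)
  refine hi.mono' (by fun_prop) (.of_forall fun p => ?_)
  rw [Real.norm_eq_abs, abs_mul]
  have h1 : ‖x + s • p.1 + t • p.2‖ ≤ ‖x‖ + |s| * ‖p.1‖ + |t| * ‖p.2‖ := by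
    refine norm_add₃_le.trans ?_
    simp [norm_smul]
  have h2 : 1 + ‖x + s • p.1 + t • p.2‖ ≤ (1 + ‖x‖ + |s| + |t|) * ((1 + ‖p.1‖) * (1 + ‖p.2‖)) := by
    have e0 := norm_nonneg x
    have e1 := norm_nonneg p.1
    have e2 := norm_nonneg p.2
    have e3 := abs_nonneg s
    have e4 := abs_nonneg t
    have e5 : 1 ≤ (1 + ‖p.1‖) * (1 + ‖p.2‖) := by nlinarith [mul_nonneg e1 e2]
    have e6 : ‖p.1‖ ≤ (1 + ‖p.1‖) * (1 + ‖p.2‖) := by nlinarith [mul_nonneg e1 e2]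
    have e7 : ‖p.2‖ ≤ (1 + ‖p.1‖) * (1 + ‖p.2‖) := by nlinarith [mul_nonneg e1 e2]
    nlinarith [mul_le_mul_of_nonneg_left e5 e0, mul_le_mul_of_nonneg_left e6 e3,
      mul_le_mul_of_nonneg_left e7 e4]
  calc |h (x + s • p.1 + t • p.2)| * |w p.1|
      ≤ (K * ((1 + ‖x‖ + |s| + |t|) * ((1 + ‖p.1‖) * (1 + ‖p.2‖)))) * (A * (1 + ‖p.1‖) ^ k) := by
        gcongr
        · exact (hK _).trans (by gcongr)
        · exact hA _
    _ = _ := by ring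

theorem integral_gaussHess_add {h : E → ℝ} (hh : LinearGrowth h) (s t : ℝ) (v y : E) :
    ∫ z, gaussHess s v h (y + t • z) ∂(stdGaussian E) = gaussHess s v (gaussSmooth t h) y := by
  simp only [gaussHess, gaussSmooth]
  rw [integral_const_mul]
  congr 1
  simp_rw [← integral_mul_const]
  have := (hh.integrable_prod y s t (by fun_prop) (abs_hermite_le v))
  rw [integral_integral_swap]
  · simp_rw [add_right_comm]
  · refine this.swap.congr (.of_forall fun p => ?_)
    simp [Function.uncurry, add_right_comm y]

/-- Gaussian smoothing at scales `r sin θ` and `r cos θ` amounts to smoothing at scale `r`. -/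
theorem gaussHess_gaussSmooth {h : E → ℝ} (hh : LinearGrowth h) {r θ : ℝ} (hr : r ≠ 0)
    (hθ : Real.cos θ ≠ 0) (v y : E) :
    gaussHess (r * Real.cos θ) v (gaussSmooth (r * Real.sin θ) h) y = gaussHess r v h y := by
  simp only [gaussHess, gaussSmooth]
  simp_rw [← integral_mul_const]
  have hc := hh.1
  have hi := hh.integrable_prod y (r * Real.cos θ) (r * Real.sin θ) (by fun_prop)
    (abs_hermite_le v)
  rw [← integral_prod (fun p : E × E => h (y + (r * Real.cos θ) • p.1 + (r * Real.sin θ) • p.2) *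
    (⟪v, p.1⟫ ^ 2 - ‖v‖ ^ 2)) hi]
  -- Rotating by `-θ` makes the argument of `h` depend on `p.1` alone, while `⟪v, p.1⟫` becomes `cos
  -- θ ⟪v, p.1⟫ - sin θ ⟪v, p.2⟫`.
  have hrot := integral_rotation_stdGaussian (fun p : E × E =>
    h (y + (r * Real.cos θ) • p.1 + (r * Real.sin θ) • p.2) * (⟪v, p.1⟫ ^ 2 - ‖v‖ ^ 2))
    (by fun_prop) (-θ)
  rw [← hrot]
  have hcs := Real.cos_sq_add_sin_sq θ
  -- After expansion the last two terms have mean zero in `p.2`. The first survives with factor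
  -- `cos² θ`, which cancels against `(r cos θ)⁻²` to leave `r⁻²`.
  have e : ∀ p : E × E, h (y + (r * Real.cos θ) • (Real.cos (-θ) • p.1 + Real.sin (-θ) • p.2) +
      (r * Real.sin θ) • (-Real.sin (-θ) • p.1 + Real.cos (-θ) • p.2)) *
      (⟪v, Real.cos (-θ) • p.1 + Real.sin (-θ) • p.2⟫ ^ 2 - ‖v‖ ^ 2) =
      Real.cos θ ^ 2 * (h (y + r • p.1) * (⟪v, p.1⟫ ^ 2 - ‖v‖ ^ 2))
      + (-2 * Real.cos θ * Real.sin θ) * ((h (y + r • p.1) * ⟪v, p.1⟫) * ⟪v, p.2⟫)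
      + Real.sin θ ^ 2 * (h (y + r • p.1) * (⟪v, p.2⟫ ^ 2 - ‖v‖ ^ 2)) := by
    intro p
    have : y + (r * Real.cos θ) • (Real.cos (-θ) • p.1 + Real.sin (-θ) • p.2) +
      (r * Real.sin θ) • (-Real.sin (-θ) • p.1 + Real.cos (-θ) • p.2) = y + r • p.1 := by
      rw [Real.cos_neg, Real.sin_neg, neg_neg, add_assoc]
      congr 1
      have e1 : r • p.1 = (r * (Real.cos θ ^ 2 + Real.sin θ ^ 2)) • p.1 := by rw [hcs, mul_one]
      rw [e1]
      module
    rw [this, inner_add_right, real_inner_smul_right, real_inner_smul_right, Real.cos_neg,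
      Real.sin_neg]
    linear_combination (h (y + r • p.1) * ‖v‖ ^ 2) * hcs
  simp_rw [e]
  have i1 := (hh.integrable_mul_hermite y v r).mul_prod (integrable_const (1 : ℝ)
    (μ := stdGaussian E))
  have i2 := (hh.integrable_mul_inner y v r).mul_prod
    (IsGaussian.integrable_dual (stdGaussian E) (innerSL ℝ v))
  have i3 := (hh.integrable y r).mul_prod (integrable_hermite v)
  simp only [mul_one, innerSL_apply_apply] at i1 i2
  have i12 : Integrable (fun p : E × E =>
      Real.cos θ ^ 2 * (h (y + r • p.1) * (⟪v, p.1⟫ ^ 2 - ‖v‖ ^ 2))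
      + (-2 * Real.cos θ * Real.sin θ) * ((h (y + r • p.1) * ⟪v, p.1⟫) * ⟪v, p.2⟫))
      ((stdGaussian E).prod (stdGaussian E)) := (i1.const_mul _).add (i2.const_mul _)
  rw [integral_add i12 (i3.const_mul _), integral_add (i1.const_mul _) (i2.const_mul _), integral_const_mul, integral_const_mul,
    integral_const_mul]
  have j1 := integral_prod_mul (μ := stdGaussian E) (ν := stdGaussian E)
    (fun z => h (y + r • z) * (⟪v, z⟫ ^ 2 - ‖v‖ ^ 2)) (fun _ => (1 : ℝ))
  have j2 := integral_prod_mul (μ := stdGaussian E) (ν := stdGaussian E)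
    (fun z => h (y + r • z) * ⟪v, z⟫) (fun z => ⟪v, z⟫)
  have j3 := integral_prod_mul (μ := stdGaussian E) (ν := stdGaussian E)
    (fun z => h (y + r • z)) (fun z => ⟪v, z⟫ ^ 2 - ‖v‖ ^ 2)
  have k2 : ∫ z, ⟪v, z⟫ ∂(stdGaussian E) = 0 := integral_strongDual_stdGaussian (innerSL ℝ v)
  have k3 : ∫ z, (⟪v, z⟫ ^ 2 - ‖v‖ ^ 2) ∂(stdGaussian E) = 0 := by
    rw [integral_sub (integrable_inner_sq_stdGaussian v) (integrable_const _),
      integral_inner_sq_stdGaussian]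
    simp
  rw [k2, mul_zero] at j2
  rw [k3, mul_zero] at j3
  simp only [mul_one, integral_const, probReal_univ, smul_eq_mul] at j1
  rw [j1, j2, j3]
  field_simp
  ring

end Smoothing

/-! ### Smooth test functions: integration by parts and Lipschitz estimates. -/

section Differentiable

open scoped RealInnerProductSpace

set_option linter.unusedSectionVars false

variable {E : Type*} [NormedAddCommGroup E] [InnerProductSpace ℝ E] [FiniteDimensional ℝ E]
  [MeasurableSpace E] [BorelSpace E]

/-- `h` is continuously differentiable with derivative `h'`, whose norm is at most `L`. -/
structure HasBoundedFDeriv (h : E → ℝ) (h' : E → E →L[ℝ] ℝ) (L : ℝ) : Prop where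
  hasFDerivAt : ∀ x, HasFDerivAt h (h' x) x
  continuous_deriv : Continuous h'
  norm_le : ∀ x, ‖h' x‖ ≤ L

namespace HasBoundedFDeriv

variable {h : E → ℝ} {h' : E → E →L[ℝ] ℝ} {L : ℝ}

theorem nonneg (H : HasBoundedFDeriv h h' L) : 0 ≤ L := (norm_nonneg _).trans (H.norm_le 0)

theorem abs_sub_le (H : HasBoundedFDeriv h h' L) (x y : E) : |h x - h y| ≤ L * ‖x - y‖ :=
  convex_univ.norm_image_sub_le_of_norm_hasFDerivWithin_le
    (fun x _ => (H.hasFDerivAt x).hasFDerivWithinAt) (fun x _ => H.norm_le x)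
    (Set.mem_univ y) (Set.mem_univ x)

theorem linearGrowth (H : HasBoundedFDeriv h h' L) : LinearGrowth h :=
  .of_lipschitz H.nonneg H.abs_sub_le

theorem continuous (H : HasBoundedFDeriv h h' L) : Continuous h := H.linearGrowth.1

theorem abs_deriv_le (H : HasBoundedFDeriv h h' L) (x v : E) : |h' x v| ≤ L * ‖v‖ :=
  (h' x).le_of_opNorm_le (H.norm_le x) v

theorem linearGrowth_deriv (H : HasBoundedFDeriv h h' L) (v : E) :
    LinearGrowth (fun x => h' x v) := by
  refine ⟨H.continuous_deriv.clm_apply continuous_const, L * ‖v‖, fun x => ?_⟩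
  refine (H.abs_deriv_le x v).trans (le_mul_of_one_le_right ?_ ?_)
  · exact mul_nonneg H.nonneg (norm_nonneg v)
  · linarith [norm_nonneg x]

theorem sub_translate (H : HasBoundedFDeriv h h' L) (w : E) :
    HasBoundedFDeriv (fun y => h (y + w) - h y) (fun y => h' (y + w) - h' y) (L + L) where
  hasFDerivAt x := by
    have h1 : HasFDerivAt (fun y => h (y + w)) (h' (x + w)) x :=
      (hasFDerivAt_comp_add_right w).2 (H.hasFDerivAt (x + w))
    exact h1.sub (H.hasFDerivAt x)
  continuous_deriv := by
    have := H.continuous_deriv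
    fun_prop
  norm_le x := (norm_sub_le _ _).trans (add_le_add (H.norm_le _) (H.norm_le _))

theorem hasFDerivAt_affine (H : HasBoundedFDeriv h h' L) (x : E) (b : ℝ) (z : E) :
    HasFDerivAt (fun z => h (x + b • z)) (b • h' (x + b • z)) z := by
  have h1 : HasFDerivAt (fun z : E => x + b • z) (b • ContinuousLinearMap.id ℝ E) z :=
    ((hasFDerivAt_id z).const_smul b).const_add x
  have h2 := (H.hasFDerivAt (x + b • z)).comp z h1
  refine h2.congr_fderiv ?_
  ext v
  simp

theorem integral_deriv_stdGaussian (H : HasBoundedFDeriv h h' L) {b : ℝ} (hb : b ≠ 0) (x v : E) :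
    ∫ z, h' (x + b • z) v ∂(stdGaussian E) =
      b⁻¹ * ∫ z, h (x + b • z) * ⟪v, z⟫ ∂(stdGaussian E) := by
  have key := integral_fderiv_stdGaussian (v := v) (H.hasFDerivAt_affine x b)
    (H.linearGrowth.integrable x b)
    (by simpa using ((H.linearGrowth_deriv v).integrable x b).const_mul b)
    (H.linearGrowth.integrable_mul_inner x v b)
  simp only [smul_apply, smul_eq_mul] at key
  rw [integral_const_mul] at key
  rw [← key]
  field_simp

/-- Integration by parts for the product `h (x + b • z) * ⟪v, z⟫`; differentiating the second factor
produces the `-‖v‖ ^ 2` of the Hermite kernel. -/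
theorem integral_deriv_mul_inner_stdGaussian (H : HasBoundedFDeriv h h' L) {b : ℝ} (hb : b ≠ 0)
    (x v : E) :
    ∫ z, h' (x + b • z) v * ⟪v, z⟫ ∂(stdGaussian E) = b * gaussHess b v h x := by
  have hd : ∀ z, HasFDerivAt (fun z => h (x + b • z) * ⟪v, z⟫)
      (h (x + b • z) • innerSL ℝ v + ⟪v, z⟫ • (b • h' (x + b • z))) z := fun z =>
    (H.hasFDerivAt_affine x b z).mul (innerSL ℝ v).hasFDerivAt
  have i1 := (H.linearGrowth.integrable x b).mul_const (‖v‖ ^ 2)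
  have i2 := ((H.linearGrowth_deriv v).integrable_mul_inner x v b).const_mul b
  have i3 : Integrable (fun z => h (x + b • z) * ⟪v, z⟫ * ⟪v, z⟫) (stdGaussian E) := by
    refine ((H.linearGrowth.integrable_mul_hermite x v b).add i1).congr (.of_forall fun z => ?_)
    simp only [Pi.add_apply]
    ring
  have e : ∀ z, (h (x + b • z) • innerSL ℝ v + ⟪v, z⟫ • (b • h' (x + b • z))) v =
      h (x + b • z) * ‖v‖ ^ 2 + b * (h' (x + b • z) v * ⟪v, z⟫) := by
    intro z
    simp only [add_apply, smul_apply, smul_eq_mul, innerSL_apply_apply, real_inner_self_eq_norm_sq]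
    ring
  have key := integral_fderiv_stdGaussian (v := v) hd
    (H.linearGrowth.integrable_mul_inner x v b) (by simp_rw [e]; exact i1.add i2) i3
  simp_rw [e] at key
  rw [integral_add i1 i2, integral_const_mul] at key
  have e2 : ∫ z, h (x + b • z) * (⟪v, z⟫ ^ 2 - ‖v‖ ^ 2) ∂(stdGaussian E) =
      b * ∫ z, h' (x + b • z) v * ⟪v, z⟫ ∂(stdGaussian E) := by
    rw [← sub_eq_iff_eq_add'.mpr key.symm, ← integral_sub i3 i1]
    congr 1
    ext z
    ring
  rw [gaussHess, e2]
  field_simp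

theorem hasDerivAt_line (H : HasBoundedFDeriv h h' L) (x v : E) (s : ℝ) :
    HasDerivAt (fun s : ℝ => h (x + s • v)) (h' (x + s • v) v) s := by
  have h1 : HasDerivAt (fun s : ℝ => x + s • v) v s := by
    simpa using ((hasDerivAt_id s).smul_const v).const_add x
  exact (H.hasFDerivAt _).comp_hasDerivAt s h1

/-- Used with weight `1` for the first derivative of a smoothing and with weight `⟪v, ·⟫` for the
second. -/
theorem hasDerivAt_integral_line (H : HasBoundedFDeriv h h' L) {w : E → ℝ} (hw : Continuous w)
    {A : ℝ} {k : ℕ} (hA : ∀ z, |w z| ≤ A * (1 + ‖z‖) ^ k) (x v : E) (b s : ℝ) :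
    HasDerivAt (fun s : ℝ => ∫ z, h (x + s • v + b • z) * w z ∂(stdGaussian E))
      (∫ z, h' (x + s • v + b • z) v * w z ∂(stdGaussian E)) s := by
  have hc := H.continuous
  have hc' := H.continuous_deriv
  refine (hasDerivAt_integral_of_dominated_loc_of_deriv_le (μ := stdGaussian E)
    (F := fun s z => h (x + s • v + b • z) * w z)
    (F' := fun s z => h' (x + s • v + b • z) v * w z) (s := Set.univ)
    (bound := fun z => L * ‖v‖ * (A * (1 + ‖z‖) ^ k)) Filter.univ_mem
    (.of_forall fun s => by fun_prop) (H.linearGrowth.integrable_mul _ b hw hA)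
    (by fun_prop) (.of_forall fun z s _ => ?_) ?_ (.of_forall fun z s _ => ?_)).2
  · rw [Real.norm_eq_abs, abs_mul]
    exact mul_le_mul (H.abs_deriv_le _ v) (hA z) (abs_nonneg _)
      (mul_nonneg H.nonneg (norm_nonneg v))
  · exact ((integrable_one_add_norm_pow_stdGaussian k).const_mul A).const_mul _
  · simp_rw [add_right_comm x _ (b • z)]
    exact (H.hasDerivAt_line (x + b • z) v s).mul_const (w z)

/-- Smoothing a bounded function at scale `t` gives a Lipschitz function. -/
theorem abs_gaussSmooth_sub_le (H : HasBoundedFDeriv h h' L) {M : ℝ} (hM : ∀ x, |h x| ≤ M)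
    {t : ℝ} (ht : 0 < t) (x y : E) :
    |gaussSmooth t h x - gaussSmooth t h y| ≤ M / t * ‖x - y‖ := by
  have hM0 : 0 ≤ M := (abs_nonneg _).trans (hM 0)
  -- Integration by parts frees the derivative of `h'`, so that the bound involves `M` and not `L`.
  have hd : ∀ s : ℝ, HasDerivAt (fun s : ℝ => gaussSmooth t h (y + s • (x - y)))
      (t⁻¹ * ∫ z, h (y + s • (x - y) + t • z) * ⟪x - y, z⟫ ∂(stdGaussian E)) s := by
    intro s
    have h1 := H.hasDerivAt_integral_line (w := fun _ => 1) (by fun_prop) (A := 1) (k := 0)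
      (by simp) y (x - y) t s
    simp only [mul_one] at h1
    rwa [H.integral_deriv_stdGaussian ht.ne'] at h1
  have hb : ∀ s : ℝ, ‖t⁻¹ * ∫ z, h (y + s • (x - y) + t • z) * ⟪x - y, z⟫ ∂(stdGaussian E)‖ ≤
      M / t * ‖x - y‖ := by
    intro s
    have h1 := abs_integral_mul_le_of_abs_le (h := fun z => h (y + s • (x - y) + t • z))
      (fun z => hM _) (IsGaussian.integrable_dual (stdGaussian E) (innerSL ℝ (x - y)))
    have h2 := mul_le_mul_of_nonneg_left (integral_abs_inner_stdGaussian_le (x - y)) hM0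
    simp only [innerSL_apply_apply] at h1
    rw [norm_mul, Real.norm_eq_abs, Real.norm_eq_abs, abs_of_pos (inv_pos.mpr ht),
      div_eq_inv_mul, mul_assoc]
    gcongr
    linarith
  have := norm_image_sub_le_of_norm_deriv_le_segment_01'
    (fun s _ => (hd s).hasDerivWithinAt) (fun s _ => hb s)
  simpa using this

/-- The increments of the second derivative of a smoothing at scale `r` are Lipschitz, with a
constant of order `L / r ^ 3`. -/
theorem abs_gaussHess_add_sub_sub_le (H : HasBoundedFDeriv h h' L) {r : ℝ} (hr : 0 < r)
    (v w x y : E) :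
    |(gaussHess r v h (x + w) - gaussHess r v h x) -
      (gaussHess r v h (y + w) - gaussHess r v h y)| ≤
      6 * L * ‖v‖ ^ 2 * ‖w‖ / r ^ 3 * ‖x - y‖ := by
  have Hk := H.sub_translate w
  have hM : ∀ x, |h (x + w) - h x| ≤ L * ‖w‖ := fun x => by simpa using H.abs_sub_le (x + w) x
  rw [gaussHess_add_sub H.linearGrowth, gaussHess_add_sub H.linearGrowth]
  -- The angle `π / 4` splits the scale `r` into two smoothings at scale `r / √2`. One makes the
  -- bounded increment of `h` Lipschitz, the other absorbs two derivatives. The resulting constant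
  -- `4 √2` is rounded up to `6`.
  have hcos : Real.cos (Real.pi / 4) ≠ 0 := by rw [Real.cos_pi_div_four]; positivity
  rw [← gaussHess_gaussSmooth Hk.linearGrowth hr.ne' hcos,
    ← gaussHess_gaussSmooth Hk.linearGrowth hr.ne' hcos, Real.cos_pi_div_four,
    Real.sin_pi_div_four]
  have ht : 0 < r * (√2 / 2) := by positivity
  have hL := H.nonneg
  refine (abs_gaussHess_sub_le (by positivity) (Hk.abs_gaussSmooth_sub_le hM ht) _ v x y).trans ?_
  refine mul_le_mul_of_nonneg_right ?_ (norm_nonneg _)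
  have h2 : √2 ^ 2 = 2 := Real.sq_sqrt (by norm_num)
  have h3 : √2 ≤ 3 / 2 := Real.sqrt_le_iff.mpr (by norm_num)
  have e : 2 * (L * ‖w‖ / (r * (√2 / 2))) * ‖v‖ ^ 2 / (r * (√2 / 2)) ^ 2 =
      4 * √2 * (L * ‖v‖ ^ 2 * ‖w‖ / r ^ 3) := by
    have h4 : (r * (√2 / 2)) ^ 2 = r ^ 2 / 2 := by rw [mul_pow, div_pow, h2]; ring
    rw [h4]
    field_simp
    rw [h2]
    ring
  rw [e]
  have : 0 ≤ L * ‖v‖ ^ 2 * ‖w‖ / r ^ 3 := by positivity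
  calc 4 * √2 * (L * ‖v‖ ^ 2 * ‖w‖ / r ^ 3) ≤ 4 * (3 / 2) * (L * ‖v‖ ^ 2 * ‖w‖ / r ^ 3) := by
        gcongr
    _ = _ := by ring

end HasBoundedFDeriv

end Differentiable

/-! ### Taylor expansion of the smoothed gradient around the remaining summands. -/

section Taylor

open scoped RealInnerProductSpace

set_option linter.unusedSectionVars false

variable {E : Type*} [NormedAddCommGroup E] [InnerProductSpace ℝ E] [FiniteDimensional ℝ E]
  [MeasurableSpace E] [BorelSpace E]

/-- The derivative in direction `v` of the Gaussian smoothing of a function with derivative `h'`. -/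
noncomputable def gaussGrad (b : ℝ) (v : E) (h' : E → E →L[ℝ] ℝ) (x : E) : ℝ :=
  ∫ z, h' (x + b • z) v ∂(stdGaussian E)

namespace HasBoundedFDeriv

variable {h : E → ℝ} {h' : E → E →L[ℝ] ℝ} {L : ℝ}

theorem stronglyMeasurable_gaussGrad (H : HasBoundedFDeriv h h' L) (b : ℝ) :
    StronglyMeasurable (fun q : E × E => gaussGrad b q.1 h' q.2) := by
  have hc := H.continuous_deriv
  have : Continuous (fun p : (E × E) × E => h' (p.1.2 + b • p.2) p.1.1) := by fun_prop
  exact this.stronglyMeasurable.integral_prod_right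

theorem stronglyMeasurable_gaussHess (H : HasBoundedFDeriv h h' L) (b : ℝ) :
    StronglyMeasurable (fun q : E × E => gaussHess b q.1 h q.2) := by
  have hc := H.continuous
  have : Continuous (fun p : (E × E) × E =>
    h (p.1.2 + b • p.2) * (⟪p.1.1, p.2⟫ ^ 2 - ‖p.1.1‖ ^ 2)) := by fun_prop
  exact this.stronglyMeasurable.integral_prod_right.const_mul _

theorem abs_gaussGrad_le (H : HasBoundedFDeriv h h' L) (b : ℝ) (v x : E) :
    |gaussGrad b v h' x| ≤ L * ‖v‖ := by
  have h1 := norm_integral_le_of_norm_le_const (μ := stdGaussian E)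
    (f := fun z => h' (x + b • z) v) (.of_forall fun z => H.abs_deriv_le (x + b • z) v)
  simpa [gaussGrad] using h1

/-- One derivative stays on `h`, so only one power of `b` is lost. -/
theorem abs_gaussHess_le_div (H : HasBoundedFDeriv h h' L) {b : ℝ} (hb : 0 < b) (v x : E) :
    |gaussHess b v h x| ≤ L / b * ‖v‖ ^ 2 := by
  have e : gaussHess b v h x = b⁻¹ * ∫ z, h' (x + b • z) v * ⟪v, z⟫ ∂(stdGaussian E) := by
    rw [H.integral_deriv_mul_inner_stdGaussian hb.ne']
    field_simp
  have h1 := abs_integral_mul_le_of_abs_le (h := fun z => h' (x + b • z) v)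
    (fun z => H.abs_deriv_le _ v) (IsGaussian.integrable_dual (stdGaussian E) (innerSL ℝ v))
  have h2 := mul_le_mul_of_nonneg_left (integral_abs_inner_stdGaussian_le v)
    (mul_nonneg H.nonneg (norm_nonneg v))
  simp only [innerSL_apply_apply] at h1
  rw [e, abs_mul, abs_of_pos (inv_pos.mpr hb), div_eq_inv_mul, mul_assoc]
  gcongr
  linarith

/-- `h'` need not be differentiable: one integration by parts moves its derivative to the weight,
the next differentiation falls on `h`, and a second integration by parts gives the Hermite kernel.
-/
theorem hasDerivAt_gaussGrad_line (H : HasBoundedFDeriv h h' L) {b : ℝ} (hb : b ≠ 0) (v x : E)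
    (s : ℝ) :
    HasDerivAt (fun s : ℝ => gaussGrad b v h' (x + s • v)) (gaussHess b v h (x + s • v)) s := by
  have h1 := (H.hasDerivAt_integral_line (w := fun z => ⟪v, z⟫) (by fun_prop)
    (abs_inner_le_growth v) x v b s).const_mul b⁻¹
  simp_rw [← H.integral_deriv_stdGaussian hb, H.integral_deriv_mul_inner_stdGaussian hb,
    inv_mul_cancel_left₀ hb] at h1
  exact h1

variable {ρ : Measure E} [IsProbabilityMeasure ρ]

theorem integrable_gaussGrad (H : HasBoundedFDeriv h h' L) (a b : ℝ) (v w : E) :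
    Integrable (fun y => gaussGrad b v h' (a • y + w)) ρ :=
  Integrable.of_bound ((H.stronglyMeasurable_gaussGrad b).comp_measurable
    (g := fun y => (v, a • y + w)) (by fun_prop)).aestronglyMeasurable _
    (.of_forall fun y => H.abs_gaussGrad_le b v _)

theorem integrable_gaussHess (H : HasBoundedFDeriv h h' L) (a : ℝ) {b : ℝ} (hb : 0 < b) (v w : E) :
    Integrable (fun y => gaussHess b v h (a • y + w)) ρ :=
  Integrable.of_bound ((H.stronglyMeasurable_gaussHess b).comp_measurable
    (g := fun y => (v, a • y + w)) (by fun_prop)).aestronglyMeasurable _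
    (.of_forall fun y => H.abs_gaussHess_le_div hb v _)

theorem hasDerivAt_integral_gaussGrad (H : HasBoundedFDeriv h h' L) (a : ℝ) {b : ℝ} (hb : 0 < b)
    (v : E) (s : ℝ) :
    HasDerivAt (fun s : ℝ => ∫ y, gaussGrad b v h' (a • y + s • v) ∂ρ)
      (∫ y, gaussHess b v h (a • y + s • v) ∂ρ) s :=
  (hasDerivAt_integral_of_dominated_loc_of_deriv_le (μ := ρ)
    (F := fun s y => gaussGrad b v h' (a • y + s • v))
    (F' := fun s y => gaussHess b v h (a • y + s • v)) (s := Set.univ)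
    (bound := fun _ => L / b * ‖v‖ ^ 2) Filter.univ_mem
    (.of_forall fun s => (H.integrable_gaussGrad a b v (s • v)).aestronglyMeasurable)
    (H.integrable_gaussGrad a b v (s • v))
    (H.integrable_gaussHess a hb v (s • v)).aestronglyMeasurable
    (.of_forall fun _ _ _ => H.abs_gaussHess_le_div hb v _) (integrable_const _)
    (.of_forall fun _ s _ => H.hasDerivAt_gaussGrad_line hb.ne' v _ s)).2

/-- The hypothesis on `K` concerns averages over `ρ` only, because the self-improving estimate is
not available pointwise. The mean value inequality is applied on `[0, a]` after removing the linear
term `s * c`. -/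
theorem abs_integral_gaussGrad_taylor_le (H : HasBoundedFDeriv h h' L) {a b K : ℝ} (ha : 0 ≤ a)
    (hb : 0 < b) (hK0 : 0 ≤ K)
    (hK : ∀ v w, |∫ y, gaussHess b v h (a • y + w) ∂ρ - ∫ y, gaussHess b v h (a • y + 0) ∂ρ| ≤
      K * ‖v‖ ^ 2 * ‖w‖) (v : E) :
    |∫ y, gaussGrad b v h' (a • y + a • v) ∂ρ - ∫ y, gaussGrad b v h' (a • y + 0) ∂ρ -
      a * ∫ y, gaussHess b v h (a • y + 0) ∂ρ| ≤ K * a ^ 2 * ‖v‖ ^ 3 := by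
  set c := ∫ y, gaussHess b v h (a • y + 0) ∂ρ
  have hd : ∀ s ∈ Set.Icc 0 a, HasDerivWithinAt
      (fun s : ℝ => ∫ y, gaussGrad b v h' (a • y + s • v) ∂ρ - s * c)
      (∫ y, gaussHess b v h (a • y + s • v) ∂ρ - c) (Set.Icc 0 a) s := fun s _ => by
    have h2 : HasDerivAt (fun s : ℝ => s * c) c s := by
      simpa using (hasDerivAt_id s).mul_const c
    exact ((H.hasDerivAt_integral_gaussGrad a hb v s).sub h2).hasDerivWithinAt
  have hbd : ∀ s ∈ Set.Ico 0 a, ‖∫ y, gaussHess b v h (a • y + s • v) ∂ρ - c‖ ≤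
      K * ‖v‖ ^ 2 * (a * ‖v‖) := fun s hs => by
    refine (hK v (s • v)).trans ?_
    rw [norm_smul, Real.norm_eq_abs, abs_of_nonneg hs.1]
    have := hs.2.le
    gcongr
  have := norm_image_sub_le_of_norm_deriv_le_segment' hd hbd a (Set.right_mem_Icc.2 ha)
  rw [Real.norm_eq_abs] at this
  simp only [zero_smul, zero_mul, sub_zero] at this
  rw [sub_right_comm]
  exact this.trans (le_of_eq (by ring))

/-- The inner integral is a fixed continuous linear functional of `v`, and `v` has mean zero. -/
theorem integral_integral_gaussGrad_eq_zero (H : HasBoundedFDeriv h h' L) (a b : ℝ)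
    {μ : Measure E} (hi : Integrable (fun v : E => v) μ) (h0 : ∫ v, v ∂μ = 0) :
    ∫ v, ∫ y, gaussGrad b v h' (a • y + 0) ∂ρ ∂μ = 0 := by
  have hc := H.continuous_deriv
  have hint : Integrable (fun p : E × E => h' (a • p.1 + b • p.2)) (ρ.prod (stdGaussian E)) :=
    Integrable.of_bound (by fun_prop) L (.of_forall fun p => H.norm_le _)
  have e : ∀ v, ∫ y, gaussGrad b v h' (a • y + 0) ∂ρ =
      (∫ p : E × E, h' (a • p.1 + b • p.2) ∂(ρ.prod (stdGaussian E))) v := by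
    intro v
    rw [ContinuousLinearMap.integral_apply hint,
      integral_prod _ (hint.apply_continuousLinearMap v)]
    simp [gaussGrad]
  simp_rw [e]
  rw [ContinuousLinearMap.integral_comp_comm _ hi, h0, map_zero]

/-- One summand of the derivative of the interpolation between the sum and the Gaussian. -/
theorem abs_integral_gaussGrad_sub_gaussHess_le (H : HasBoundedFDeriv h h' L) {a b K B : ℝ}
    (ha : 0 ≤ a) (hb : 0 < b) (hK0 : 0 ≤ K)
    (hK : ∀ v w, |∫ y, gaussHess b v h (a • y + w) ∂ρ - ∫ y, gaussHess b v h (a • y + 0) ∂ρ| ≤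
      K * ‖v‖ ^ 2 * ‖w‖)
    {μ : Measure E} [IsProbabilityMeasure μ] (hB : ∀ᵐ v ∂μ, ‖v‖ ≤ B) (h0 : ∫ v, v ∂μ = 0) :
    |∫ v, ∫ y, gaussGrad b v h' (a • y + a • v) ∂ρ ∂μ -
      a * ∫ v', ∫ v, ∫ y, gaussHess b v' h (a • y + a • v) ∂ρ ∂μ ∂μ| ≤
      2 * K * a ^ 2 * B * ∫ v, ‖v‖ ^ 2 ∂μ := by
  have hL := H.nonneg
  have hB0 : 0 ≤ B := by
    obtain ⟨v, hv⟩ := hB.exists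
    exact (norm_nonneg v).trans hv
  have hi : Integrable (fun v : E => v) μ := Integrable.of_bound (by fun_prop) B hB
  have hi2 : Integrable (fun v : E => ‖v‖ ^ 2) μ := by
    refine Integrable.of_bound (by fun_prop) (B ^ 2) ?_
    filter_upwards [hB] with v hv
    rw [norm_pow, norm_norm]
    gcongr
  have mG := (H.stronglyMeasurable_gaussGrad b)
  have mU := (H.stronglyMeasurable_gaussHess b)
  have mG1 : StronglyMeasurable (fun v => ∫ y, gaussGrad b v h' (a • y + a • v) ∂ρ) :=
    (mG.comp_measurable (g := fun p : E × E => (p.1, a • p.2 + a • p.1))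
      (by fun_prop)).integral_prod_right'
  have mG0 : StronglyMeasurable (fun v => ∫ y, gaussGrad b v h' (a • y + 0) ∂ρ) :=
    (mG.comp_measurable (g := fun p : E × E => (p.1, a • p.2 + 0))
      (by fun_prop)).integral_prod_right'
  have mU0 : StronglyMeasurable (fun v => ∫ y, gaussHess b v h (a • y + 0) ∂ρ) :=
    (mU.comp_measurable (g := fun p : E × E => (p.1, a • p.2 + 0))
      (by fun_prop)).integral_prod_right'
  have mU1 : StronglyMeasurable
      (fun p : E × E => ∫ y, gaussHess b p.1 h (a • y + a • p.2) ∂ρ) :=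
    (mU.comp_measurable (g := fun p : (E × E) × E => (p.1.1, a • p.2 + a • p.1.2))
      (by fun_prop)).integral_prod_right'
  have bG : ∀ v w, ‖∫ y, gaussGrad b v h' (a • y + w) ∂ρ‖ ≤ L * ‖v‖ := fun v w => by
    simpa using norm_integral_le_of_norm_le_const (μ := ρ)
      (f := fun y => gaussGrad b v h' (a • y + w)) (.of_forall fun y => H.abs_gaussGrad_le b v _)
  have bU : ∀ v w, ‖∫ y, gaussHess b v h (a • y + w) ∂ρ‖ ≤ L / b * ‖v‖ ^ 2 := fun v w => by
    simpa using norm_integral_le_of_norm_le_const (μ := ρ)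
      (f := fun y => gaussHess b v h (a • y + w))
      (.of_forall fun y => H.abs_gaussHess_le_div hb v _)
  have iG1 : Integrable (fun v => ∫ y, gaussGrad b v h' (a • y + a • v) ∂ρ) μ :=
    (hi.norm.const_mul L).mono' mG1.aestronglyMeasurable (.of_forall fun v => bG v _)
  have iG0 : Integrable (fun v => ∫ y, gaussGrad b v h' (a • y + 0) ∂ρ) μ :=
    (hi.norm.const_mul L).mono' mG0.aestronglyMeasurable (.of_forall fun v => bG v _)
  have iU0 : Integrable (fun v => ∫ y, gaussHess b v h (a • y + 0) ∂ρ) μ :=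
    (hi2.const_mul (L / b)).mono' mU0.aestronglyMeasurable (.of_forall fun v => bU v _)
  have iU1 : ∀ v', Integrable (fun v => ∫ y, gaussHess b v' h (a • y + a • v) ∂ρ) μ := fun v' =>
    Integrable.of_bound (mU1.comp_measurable (g := fun v => (v', v))
      (by fun_prop)).aestronglyMeasurable _ (.of_forall fun v => bU v' _)
  have iU2 : Integrable (fun v' => ∫ v, ∫ y, gaussHess b v' h (a • y + a • v) ∂ρ ∂μ) μ := by
    refine (hi2.const_mul (L / b)).mono' mU1.integral_prod_right'.aestronglyMeasurable
      (.of_forall fun v' => ?_)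
    simpa using norm_integral_le_of_norm_le_const (μ := μ) (.of_forall fun v => bU v' (a • v))
  have z0 := H.integral_integral_gaussGrad_eq_zero (ρ := ρ) a b hi h0
  -- Both terms are compared with the second derivative at `a • y`, which does not see the summand.
  -- `t1` bounds the Taylor remainder and `t2` the shift of the base point, where `v'` is a copy of
  -- the summand independent of `v`.
  have e : ∫ v, ∫ y, gaussGrad b v h' (a • y + a • v) ∂ρ ∂μ -
      a * ∫ v', ∫ v, ∫ y, gaussHess b v' h (a • y + a • v) ∂ρ ∂μ ∂μ =
      ∫ v, (∫ y, gaussGrad b v h' (a • y + a • v) ∂ρ - ∫ y, gaussGrad b v h' (a • y + 0) ∂ρ -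
        a * ∫ y, gaussHess b v h (a • y + 0) ∂ρ) ∂μ -
      a * ∫ v', (∫ v, ∫ y, gaussHess b v' h (a • y + a • v) ∂ρ ∂μ -
        ∫ y, gaussHess b v' h (a • y + 0) ∂ρ) ∂μ := by
    have iG10 : Integrable (fun v => ∫ y, gaussGrad b v h' (a • y + a • v) ∂ρ -
        ∫ y, gaussGrad b v h' (a • y + 0) ∂ρ) μ := iG1.sub iG0
    rw [integral_sub iG10 (iU0.const_mul a), integral_sub iG1 iG0, z0,
      integral_sub iU2 iU0, integral_const_mul]
    ring
  have t1 : |∫ v, (∫ y, gaussGrad b v h' (a • y + a • v) ∂ρ -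
        ∫ y, gaussGrad b v h' (a • y + 0) ∂ρ - a * ∫ y, gaussHess b v h (a • y + 0) ∂ρ) ∂μ| ≤
      K * a ^ 2 * B * ∫ v, ‖v‖ ^ 2 ∂μ := by
    rw [← integral_const_mul, ← Real.norm_eq_abs]
    refine norm_integral_le_of_norm_le (hi2.const_mul _) ?_
    filter_upwards [hB] with v hv
    refine (H.abs_integral_gaussGrad_taylor_le ha hb hK0 hK v).trans ?_
    calc K * a ^ 2 * ‖v‖ ^ 3 = K * a ^ 2 * ‖v‖ * ‖v‖ ^ 2 := by ring
      _ ≤ _ := by gcongr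
  have t2 : |∫ v', (∫ v, ∫ y, gaussHess b v' h (a • y + a • v) ∂ρ ∂μ -
        ∫ y, gaussHess b v' h (a • y + 0) ∂ρ) ∂μ| ≤ K * a * B * ∫ v, ‖v‖ ^ 2 ∂μ := by
    rw [← integral_const_mul, ← Real.norm_eq_abs]
    refine norm_integral_le_of_norm_le (hi2.const_mul _) (.of_forall fun v' => ?_)
    have e1 : ∫ v, ∫ y, gaussHess b v' h (a • y + a • v) ∂ρ ∂μ -
        ∫ y, gaussHess b v' h (a • y + 0) ∂ρ = ∫ v, (∫ y, gaussHess b v' h (a • y + a • v) ∂ρ -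
        ∫ y, gaussHess b v' h (a • y + 0) ∂ρ) ∂μ := by
      rw [integral_sub (iU1 v') (integrable_const _)]
      simp
    rw [e1]
    have := norm_integral_le_of_norm_le_const (μ := μ) (C := K * a * B * ‖v'‖ ^ 2)
      (f := fun v => ∫ y, gaussHess b v' h (a • y + a • v) ∂ρ -
        ∫ y, gaussHess b v' h (a • y + 0) ∂ρ) ?_
    · simpa using this
    filter_upwards [hB] with v hv
    refine (hK v' (a • v)).trans ?_
    rw [norm_smul, Real.norm_eq_abs, abs_of_nonneg ha]
    calc K * ‖v'‖ ^ 2 * (a * ‖v‖) = K * a * ‖v‖ * ‖v'‖ ^ 2 := by ring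
      _ ≤ _ := by gcongr
  rw [e]
  refine (abs_sub _ _).trans ?_
  rw [abs_mul, abs_of_nonneg ha]
  have := mul_le_mul_of_nonneg_left t2 ha
  linarith

end HasBoundedFDeriv

end Taylor

/-! ### Isotropic families and the derivative of the interpolation. -/

section Interpolation

open scoped RealInnerProductSpace

set_option linter.unusedSectionVars false

variable {E : Type*} [NormedAddCommGroup E] [InnerProductSpace ℝ E] [FiniteDimensional ℝ E]
  [MeasurableSpace E] [BorelSpace E]

/-- Independent centred random vectors with norms bounded by `B`, whose sum has identity
covariance. -/
structure IsIsotropicFamily {Ω ι : Type*} [MeasurableSpace Ω] [Fintype ι] (P : Measure Ω)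
    (ξ : ι → Ω → E) (B : ℝ) : Prop where
  measurable : ∀ i, Measurable (ξ i)
  iIndepFun : iIndepFun ξ P
  integral_eq_zero : ∀ i, ∫ ω, ξ i ω ∂P = 0
  norm_le : ∀ i, ∀ᵐ ω ∂P, ‖ξ i ω‖ ≤ B
  covariance : ∀ u v, ∫ ω, ⟪u, ∑ i, ξ i ω⟫ * ⟪v, ∑ i, ξ i ω⟫ ∂P = ⟪u, v⟫

variable {Ω ι : Type*} [MeasurableSpace Ω] [Fintype ι] [DecidableEq ι] {P : Measure Ω}
  [IsProbabilityMeasure P] {ξ : ι → Ω → E} {B : ℝ}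

namespace IsIsotropicFamily

theorem map_prod_eq (X : IsIsotropicFamily P ξ B) (i : ι) :
    P.map (fun ω => (ξ i ω, ∑ j ∈ Finset.univ.erase i, ξ j ω)) =
      (P.map (ξ i)).prod (P.map (fun ω => ∑ j ∈ Finset.univ.erase i, ξ j ω)) := by
  have h1 := X.iIndepFun.indepFun_finsetSum_of_notMem X.measurable
    (Finset.notMem_erase i Finset.univ)
  have e : (∑ j ∈ Finset.univ.erase i, ξ j) = fun ω => ∑ j ∈ Finset.univ.erase i, ξ j ω := by
    ext1 ω
    simp
  rw [e] at h1
  have hm := X.measurable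
  exact (indepFun_iff_map_prod_eq_prod_map_map (hm i).aemeasurable
    (by fun_prop)).1 h1.symm

theorem ae_norm_le (X : IsIsotropicFamily P ξ B) (i : ι) : ∀ᵐ v ∂(P.map (ξ i)), ‖v‖ ≤ B :=
  (ae_map_iff (X.measurable i).aemeasurable (measurableSet_le measurable_norm measurable_const)).2
    (X.norm_le i)

theorem bound_nonneg (X : IsIsotropicFamily P ξ B) (i : ι) : 0 ≤ B := by
  obtain ⟨ω, hω⟩ := (X.norm_le i).exists
  exact (norm_nonneg _).trans hω

theorem integrable (X : IsIsotropicFamily P ξ B) (i : ι) : Integrable (ξ i) P :=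
  Integrable.of_bound (X.measurable i).aestronglyMeasurable B (X.norm_le i)

theorem integrable_norm_sq (X : IsIsotropicFamily P ξ B) (i : ι) :
    Integrable (fun ω => ‖ξ i ω‖ ^ 2) P := by
  have := X.measurable i
  refine Integrable.of_bound (by fun_prop) (B ^ 2) ?_
  filter_upwards [X.norm_le i] with ω hω
  rw [norm_pow, norm_norm]
  gcongr

/-- Integrals of functions of one summand and the sum of the others. -/
theorem integral_eq_integral_integral (X : IsIsotropicFamily P ξ B) (i : ι) {f : E × E → ℝ}
    (hf : StronglyMeasurable f) {C : ℝ} (hC : ∀ v y, ‖v‖ ≤ B → |f (v, y)| ≤ C) :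
    ∫ ω, f (ξ i ω, ∑ j ∈ Finset.univ.erase i, ξ j ω) ∂P =
      ∫ v, ∫ y, f (v, y) ∂(P.map (fun ω => ∑ j ∈ Finset.univ.erase i, ξ j ω)) ∂(P.map (ξ i)) := by
  have hm := X.measurable
  have h1 : IsProbabilityMeasure (P.map (ξ i)) :=
    Measure.isProbabilityMeasure_map (hm i).aemeasurable
  have h2 : IsProbabilityMeasure (P.map (fun ω => ∑ j ∈ Finset.univ.erase i, ξ j ω)) :=
    Measure.isProbabilityMeasure_map (by fun_prop)
  rw [← integral_prod, ← X.map_prod_eq, integral_map (by fun_prop) hf.aestronglyMeasurable]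
  refine Integrable.of_bound hf.aestronglyMeasurable C ?_
  filter_upwards [Measure.quasiMeasurePreserving_fst.ae (X.ae_norm_le i)] with p hp using hC p.1 p.2 hp

/-- Cross terms vanish by independence and centring. -/
theorem sum_covariance (X : IsIsotropicFamily P ξ B) (u v : E) :
    ∑ i, ∫ ω, ⟪u, ξ i ω⟫ * ⟪v, ξ i ω⟫ ∂P = ⟪u, v⟫ := by
  have hm := X.measurable
  have hint : ∀ i j, Integrable (fun ω => ⟪u, ξ i ω⟫ * ⟪v, ξ j ω⟫) P := fun i j => by
    refine Integrable.of_bound (by fun_prop) ((‖u‖ * B) * (‖v‖ * B)) ?_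
    filter_upwards [X.norm_le i, X.norm_le j] with ω h1 h2
    rw [norm_mul]
    exact mul_le_mul ((norm_inner_le_norm _ _).trans (by gcongr))
      ((norm_inner_le_norm _ _).trans (by gcongr)) (norm_nonneg _)
      (mul_nonneg (norm_nonneg _) (X.bound_nonneg i))
  have hoff : ∀ i j, i ≠ j → ∫ ω, ⟪u, ξ i ω⟫ * ⟪v, ξ j ω⟫ ∂P = 0 := fun i j hij => by
    have h1 : IndepFun (fun ω => ⟪u, ξ i ω⟫) (fun ω => ⟪v, ξ j ω⟫) P :=
      (X.iIndepFun.indepFun hij).comp (φ := fun x => ⟪u, x⟫) (ψ := fun x => ⟪v, x⟫)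
        (by fun_prop) (by fun_prop)
    rw [h1.integral_fun_mul_eq_mul_integral (by fun_prop) (by fun_prop),
      integral_inner (X.integrable i), X.integral_eq_zero i]
    simp
  rw [← X.covariance u v]
  simp_rw [inner_sum, Finset.sum_mul_sum]
  rw [integral_finsetSum _ fun i _ => integrable_finsetSum _ fun j _ => hint i j]
  refine Finset.sum_congr rfl fun i _ => ?_
  rw [integral_finsetSum _ fun j _ => hint i j, Finset.sum_eq_single i]
  · exact fun j _ hj => hoff i j hj.symm
  · simp

theorem memLp_sum (X : IsIsotropicFamily P ξ B) : MemLp (fun ω => ∑ i, ξ i ω) 2 P :=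
  memLp_finsetSum _ fun i _ =>
    MemLp.of_bound (X.measurable i).aestronglyMeasurable B (X.norm_le i)

theorem integrable_sum (X : IsIsotropicFamily P ξ B) : Integrable (fun ω => ∑ i, ξ i ω) P :=
  integrable_finsetSum _ fun i _ => X.integrable i

theorem integral_norm_sq_sum (X : IsIsotropicFamily P ξ B) :
    ∫ ω, ‖∑ i, ξ i ω‖ ^ 2 ∂P = Module.finrank ℝ E := by
  have hm := X.measurable
  have e : ∀ ω, ‖∑ i, ξ i ω‖ ^ 2 =
      ∑ k, ⟪stdOrthonormalBasis ℝ E k, ∑ i, ξ i ω⟫ * ⟪stdOrthonormalBasis ℝ E k, ∑ i, ξ i ω⟫ := by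
    intro ω
    rw [← (stdOrthonormalBasis ℝ E).sum_sq_inner_right]
    simp_rw [pow_two]
  simp_rw [e]
  rw [integral_finsetSum]
  · simp [X.covariance]
  · intro k _
    refine X.memLp_sum.norm.integrable_sq.mono' (by fun_prop) (.of_forall fun ω => ?_)
    rw [← pow_two, norm_pow]
    gcongr
    refine (norm_inner_le_norm _ _).trans ?_
    simp

theorem integral_norm_sum_le (X : IsIsotropicFamily P ξ B) :
    ∫ ω, ‖∑ i, ξ i ω‖ ∂P ≤ √(Module.finrank ℝ E) := by
  have h := variance_nonneg (fun ω => ‖∑ i, ξ i ω‖) P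
  rw [variance_eq_sub X.memLp_sum.norm] at h
  simp only [Pi.pow_apply, X.integral_norm_sq_sum] at h
  exact Real.le_sqrt_of_sq_le (by linarith)

theorem sum_integral_norm_sq (X : IsIsotropicFamily P ξ B) :
    ∑ i, ∫ ω, ‖ξ i ω‖ ^ 2 ∂P = Module.finrank ℝ E := by
  have e : ∀ i, ∫ ω, ‖ξ i ω‖ ^ 2 ∂P =
      ∑ k, ∫ ω, ⟪stdOrthonormalBasis ℝ E k, ξ i ω⟫ * ⟪stdOrthonormalBasis ℝ E k, ξ i ω⟫ ∂P := by
    intro i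
    rw [← integral_finsetSum]
    · congr 1
      ext ω
      rw [← (stdOrthonormalBasis ℝ E).sum_sq_inner_right]
      simp_rw [pow_two]
    · intro k _
      have := X.measurable i
      refine (X.integrable_norm_sq i).mono' (by fun_prop) (.of_forall fun ω => ?_)
      rw [← pow_two, norm_pow]
      gcongr
      refine (norm_inner_le_norm _ _).trans ?_
      simp
  simp_rw [e]
  rw [Finset.sum_comm]
  simp [X.sum_covariance]

theorem sum_integral_clm_mul_inner (X : IsIsotropicFamily P ξ B) (l : E →L[ℝ] ℝ) (z : E) :
    ∑ i, ∫ v, l v * ⟪v, z⟫ ∂(P.map (ξ i)) = l z := by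
  have h1 : ∀ v, l v = ⟪(InnerProductSpace.toDual ℝ E).symm l, v⟫ := fun v => by simp
  have e : ∀ i, ∫ v, l v * ⟪v, z⟫ ∂(P.map (ξ i)) =
      ∫ ω, ⟪(InnerProductSpace.toDual ℝ E).symm l, ξ i ω⟫ * ⟪z, ξ i ω⟫ ∂P := by
    intro i
    rw [integral_map (X.measurable i).aemeasurable (by fun_prop)]
    simp_rw [h1, real_inner_comm z]
  simp_rw [e, X.sum_covariance, ← h1]

end IsIsotropicFamily

namespace HasBoundedFDeriv

variable {h : E → ℝ} {h' : E → E →L[ℝ] ℝ} {L : ℝ}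

/-- The covariances sum to the identity, so `l z` is the sum over `i` of the means of `l v * ⟪v, z⟫`
with `v` distributed as `ξ i`. Integration by parts for each fixed `v` then gives a sum indexed like
`W`, ready for cancellation. -/
theorem integral_deriv_apply_self (H : HasBoundedFDeriv h h' L) (X : IsIsotropicFamily P ξ B)
    {b : ℝ} (hb : b ≠ 0) (x : E) :
    ∫ z, h' (x + b • z) z ∂(stdGaussian E) =
      b * ∑ i, ∫ v, gaussHess b v h x ∂(P.map (ξ i)) := by
  have hc := H.continuous_deriv
  have hL := H.nonneg
  have hprob : ∀ i, IsProbabilityMeasure (P.map (ξ i)) := fun i =>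
    Measure.isProbabilityMeasure_map (X.measurable i).aemeasurable
  have hint : ∀ i, Integrable (fun p : E × E => h' (x + b • p.2) p.1 * ⟪p.1, p.2⟫)
      ((P.map (ξ i)).prod (stdGaussian E)) := by
    intro i
    have hB := X.bound_nonneg i
    have i1 : Integrable (fun p : E × E => (L * B ^ 2) * ‖p.2‖)
        ((P.map (ξ i)).prod (stdGaussian E)) := by
      have := (integrable_const (1 : ℝ) (μ := P.map (ξ i))).mul_prod
        (IsGaussian.integrable_id (μ := stdGaussian E)).norm
      simp only [one_mul, id] at this
      exact this.const_mul _
    refine i1.mono' (by fun_prop) ?_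
    filter_upwards [Measure.quasiMeasurePreserving_fst.ae (X.ae_norm_le i)] with p hp
    rw [norm_mul, Real.norm_eq_abs, Real.norm_eq_abs]
    calc |h' (x + b • p.2) p.1| * |⟪p.1, p.2⟫| ≤ (L * ‖p.1‖) * (‖p.1‖ * ‖p.2‖) :=
          mul_le_mul (H.abs_deriv_le _ _) (abs_real_inner_le_norm _ _) (abs_nonneg _)
            (by positivity)
      _ ≤ (L * B) * (B * ‖p.2‖) := by gcongr
      _ = _ := by ring
  have e : ∀ z, h' (x + b • z) z = ∑ i, ∫ v, h' (x + b • z) v * ⟪v, z⟫ ∂(P.map (ξ i)) :=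
    fun z => (X.sum_integral_clm_mul_inner _ z).symm
  simp_rw [e]
  rw [integral_finsetSum _ fun i _ => (hint i).integral_prod_right, Finset.mul_sum]
  refine Finset.sum_congr rfl fun i _ => ?_
  rw [← integral_integral_swap (hint i), ← integral_const_mul]
  simp_rw [H.integral_deriv_mul_inner_stdGaussian hb]

/-- The derivative of the interpolation `t ↦ E h (cos t W + sin t Z)` between the law of the sum
`W` of an isotropic family and the standard Gaussian. -/
theorem exists_hasDerivAt_interpolation (H : HasBoundedFDeriv h h' L)
    (X : IsIsotropicFamily P ξ B) {t K : ℝ} (ha : 0 ≤ Real.cos t) (hb : 0 < Real.sin t)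
    (hK0 : 0 ≤ K)
    (hK : ∀ i v w,
      |∫ y, gaussHess (Real.sin t) v h (Real.cos t • y + w)
          ∂(P.map (fun ω => ∑ j ∈ Finset.univ.erase i, ξ j ω)) -
        ∫ y, gaussHess (Real.sin t) v h (Real.cos t • y + 0)
          ∂(P.map (fun ω => ∑ j ∈ Finset.univ.erase i, ξ j ω))| ≤ K * ‖v‖ ^ 2 * ‖w‖) :
    ∃ D, HasDerivAt (fun t : ℝ => ∫ p : Ω × E, h (Real.cos t • ∑ i, ξ i p.1 + Real.sin t • p.2)
        ∂(P.prod (stdGaussian E))) D t ∧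
      |D| ≤ 2 * K * Real.cos t ^ 2 * Real.sin t * B * Module.finrank ℝ E := by
  have hc := H.continuous
  have hc' := H.continuous_deriv
  have hL := H.nonneg
  have hm := X.measurable
  have iW : Integrable (fun ω => ∑ i, ξ i ω) P := integrable_finsetSum _ fun i _ => X.integrable i
  have iW1 : Integrable (fun p : Ω × E => ∑ i, ξ i p.1) (P.prod (stdGaussian E)) :=
    iW.comp_fst _
  have iZ1 : Integrable (fun p : Ω × E => p.2) (P.prod (stdGaussian E)) :=
    (IsGaussian.integrable_fun_id (μ := stdGaussian E)).comp_snd _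
  have hdot : ∀ (p : Ω × E) (s : ℝ), HasDerivAt
      (fun s : ℝ => Real.cos s • ∑ i, ξ i p.1 + Real.sin s • p.2)
      (-Real.sin s • ∑ i, ξ i p.1 + Real.cos s • p.2) s := fun p s =>
    ((Real.hasDerivAt_cos s).smul_const _).add ((Real.hasDerivAt_sin s).smul_const _)
  have hbd : ∀ (p : Ω × E) (s : ℝ), ‖-Real.sin s • ∑ i, ξ i p.1 + Real.cos s • p.2‖ ≤
      ‖∑ i, ξ i p.1‖ + ‖p.2‖ := fun p s => by
    refine (norm_add_le _ _).trans (add_le_add ?_ ?_)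
    · rw [norm_smul, norm_neg]
      exact mul_le_of_le_one_left (norm_nonneg _) (Real.abs_sin_le_one s)
    · rw [norm_smul]
      exact mul_le_of_le_one_left (norm_nonneg _) (Real.abs_cos_le_one s)
  have mder : ∀ s : ℝ, AEStronglyMeasurable (fun p : Ω × E =>
      h' (Real.cos s • ∑ i, ξ i p.1 + Real.sin s • p.2)
        (-Real.sin s • ∑ i, ξ i p.1 + Real.cos s • p.2)) (P.prod (stdGaussian E)) := fun s => by
    have h1 : Continuous (fun q : E × E => h' (Real.cos s • q.1 + Real.sin s • q.2)
      (-Real.sin s • q.1 + Real.cos s • q.2)) := by fun_prop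
    exact (h1.stronglyMeasurable.comp_measurable (g := fun p : Ω × E => (∑ i, ξ i p.1, p.2))
      (by fun_prop)).aestronglyMeasurable
  have mfun : ∀ s : ℝ, AEStronglyMeasurable (fun p : Ω × E =>
      h (Real.cos s • ∑ i, ξ i p.1 + Real.sin s • p.2)) (P.prod (stdGaussian E)) := fun s => by
    have h1 : Continuous (fun q : E × E => h (Real.cos s • q.1 + Real.sin s • q.2)) := by fun_prop
    exact (h1.stronglyMeasurable.comp_measurable (g := fun p : Ω × E => (∑ i, ξ i p.1, p.2))
      (by fun_prop)).aestronglyMeasurable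
  have ifun : Integrable (fun p : Ω × E =>
      h (Real.cos t • ∑ i, ξ i p.1 + Real.sin t • p.2)) (P.prod (stdGaussian E)) := by
    have i1 := ((iW1.smul (Real.cos t)).add (iZ1.smul (Real.sin t))).norm.const_mul L
    refine ((integrable_const |h 0|).add i1).mono' (mfun t) (.of_forall fun p => ?_)
    have h1 := H.abs_sub_le (Real.cos t • ∑ i, ξ i p.1 + Real.sin t • p.2) 0
    have h2 := abs_add_le (h (Real.cos t • ∑ i, ξ i p.1 + Real.sin t • p.2) - h 0) (h 0)
    rw [sub_add_cancel] at h2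
    rw [sub_zero] at h1
    simp only [Real.norm_eq_abs, Pi.add_apply, Pi.smul_apply] at *
    linarith
  have hder := hasDerivAt_integral_of_dominated_loc_of_deriv_le (μ := P.prod (stdGaussian E))
    (x₀ := t) (F := fun t p => h (Real.cos t • ∑ i, ξ i p.1 + Real.sin t • p.2))
    (F' := fun t p => h' (Real.cos t • ∑ i, ξ i p.1 + Real.sin t • p.2)
        (-Real.sin t • ∑ i, ξ i p.1 + Real.cos t • p.2)) (s := Set.univ)
    (bound := fun p => L * (‖∑ i, ξ i p.1‖ + ‖p.2‖)) Filter.univ_mem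
    (.of_forall mfun) ifun (mder t)
    (.of_forall fun p s _ => (H.abs_deriv_le _ _).trans
      (mul_le_mul_of_nonneg_left (hbd p s) hL))
    ((iW1.norm.add iZ1.norm).const_mul L)
    (.of_forall fun p s _ => (H.hasFDerivAt _).comp_hasDerivAt s (hdot p s))
  refine ⟨_, hder.2, ?_⟩
  set a := Real.cos t
  set b := Real.sin t
  have iAW : ∀ i, Integrable (fun p : Ω × E => h' (a • ∑ i, ξ i p.1 + b • p.2) (ξ i p.1))
      (P.prod (stdGaussian E)) := fun i => by
    have h1 : Continuous (fun q : E × E × E => h' (a • q.1 + b • q.2.1) q.2.2) := by fun_prop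
    have h2 := (h1.stronglyMeasurable.comp_measurable
      (g := fun p : Ω × E => (∑ i, ξ i p.1, p.2, ξ i p.1)) (by fun_prop)).aestronglyMeasurable
      (μ := P.prod (stdGaussian E))
    exact (((X.integrable i).comp_fst (stdGaussian E)).norm.const_mul L).mono' h2
      (.of_forall fun p => H.abs_deriv_le _ _)
  have iAZ : Integrable (fun p : Ω × E => h' (a • ∑ i, ξ i p.1 + b • p.2) p.2)
      (P.prod (stdGaussian E)) := by
    have h1 : Continuous (fun q : E × E => h' (a • q.1 + b • q.2) q.2) := by fun_prop
    have h2 := (h1.stronglyMeasurable.comp_measurable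
      (g := fun p : Ω × E => (∑ i, ξ i p.1, p.2)) (by fun_prop)).aestronglyMeasurable
      (μ := P.prod (stdGaussian E))
    exact (iZ1.norm.const_mul L).mono' h2 (.of_forall fun p => H.abs_deriv_le _ _)
  have hprob : ∀ i, IsProbabilityMeasure (P.map (ξ i)) := fun i =>
    Measure.isProbabilityMeasure_map (hm i).aemeasurable
  have hprob' : ∀ i, IsProbabilityMeasure (P.map (fun ω => ∑ j ∈ Finset.univ.erase i, ξ j ω)) :=
    fun i => Measure.isProbabilityMeasure_map (by fun_prop)
  have hW : ∀ i ω, a • ∑ j, ξ j ω = a • ∑ j ∈ Finset.univ.erase i, ξ j ω + a • ξ i ω := by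
    intro i ω
    rw [← smul_add, Finset.sum_erase_add _ _ (Finset.mem_univ i)]
  -- The Gaussian integral produces `gaussGrad`; then `ξ i` is separated from the independent sum of
  -- the others.
  have eW : ∀ i, ∫ p : Ω × E, h' (a • ∑ i, ξ i p.1 + b • p.2) (ξ i p.1) ∂(P.prod (stdGaussian E)) =
      ∫ v, ∫ y, gaussGrad b v h' (a • y + a • v)
        ∂(P.map (fun ω => ∑ j ∈ Finset.univ.erase i, ξ j ω)) ∂(P.map (ξ i)) := by
    intro i
    rw [integral_prod _ (iAW i)]
    have := X.integral_eq_integral_integral i (f := fun q => gaussGrad b q.1 h' (a • q.2 + a • q.1))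
      ((H.stronglyMeasurable_gaussGrad b).comp_measurable
        (g := fun q : E × E => (q.1, a • q.2 + a • q.1)) (by fun_prop)) (C := L * B)
      (fun v y hv => (H.abs_gaussGrad_le b v _).trans (by gcongr))
    rw [← this]
    simp_rw [← hW]
    rfl
  have eZ : ∫ p : Ω × E, h' (a • ∑ i, ξ i p.1 + b • p.2) p.2 ∂(P.prod (stdGaussian E)) =
      b * ∑ i, ∫ v', ∫ v, ∫ y, gaussHess b v' h (a • y + a • v)
        ∂(P.map (fun ω => ∑ j ∈ Finset.univ.erase i, ξ j ω)) ∂(P.map (ξ i)) ∂(P.map (ξ i)) := by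
    rw [integral_prod _ iAZ]
    simp_rw [H.integral_deriv_apply_self X hb.ne']
    have iH : ∀ i, Integrable (fun q : E × Ω => gaussHess b q.1 h (a • ∑ i, ξ i q.2))
        ((P.map (ξ i)).prod P) := fun i => by
      have hB := X.bound_nonneg i
      refine Integrable.of_bound ((H.stronglyMeasurable_gaussHess b).comp_measurable
        (g := fun q : E × Ω => (q.1, a • ∑ i, ξ i q.2)) (by fun_prop)).aestronglyMeasurable
        (L / b * B ^ 2) ?_
      filter_upwards [Measure.quasiMeasurePreserving_fst.ae (X.ae_norm_le i)] with q hq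
      exact (H.abs_gaussHess_le_div hb _ _).trans (by gcongr)
    rw [integral_const_mul, integral_finsetSum _ fun i _ => (iH i).integral_prod_right]
    congr 1
    refine Finset.sum_congr rfl fun i _ => ?_
    rw [← integral_integral_swap (iH i)]
    congr 1
    ext v'
    have := X.integral_eq_integral_integral i (f := fun q => gaussHess b v' h (a • q.2 + a • q.1))
      ((H.stronglyMeasurable_gaussHess b).comp_measurable
        (g := fun q : E × E => (v', a • q.2 + a • q.1)) (by fun_prop))
      (fun v y hv => H.abs_gaussHess_le_div hb v' _)
    rw [← this]
    simp_rw [← hW]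
  have eD : ∫ p : Ω × E, h' (a • ∑ i, ξ i p.1 + b • p.2) (-b • ∑ i, ξ i p.1 + a • p.2)
      ∂(P.prod (stdGaussian E)) = -b * ∑ i,
      (∫ v, ∫ y, gaussGrad b v h' (a • y + a • v)
        ∂(P.map (fun ω => ∑ j ∈ Finset.univ.erase i, ξ j ω)) ∂(P.map (ξ i)) -
      a * ∫ v', ∫ v, ∫ y, gaussHess b v' h (a • y + a • v)
        ∂(P.map (fun ω => ∑ j ∈ Finset.univ.erase i, ξ j ω)) ∂(P.map (ξ i)) ∂(P.map (ξ i))) := by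
    have e1 : ∀ p : Ω × E, h' (a • ∑ i, ξ i p.1 + b • p.2) (-b • ∑ i, ξ i p.1 + a • p.2) =
        -b * ∑ i, h' (a • ∑ i, ξ i p.1 + b • p.2) (ξ i p.1) +
          a * h' (a • ∑ i, ξ i p.1 + b • p.2) p.2 := fun p => by
      rw [map_add, map_smul, map_smul, map_sum, smul_eq_mul, smul_eq_mul]
    simp_rw [e1]
    rw [integral_add ((integrable_finsetSum _ fun i _ => iAW i).const_mul _) (iAZ.const_mul _),
      integral_const_mul, integral_const_mul, integral_finsetSum _ fun i _ => iAW i, eZ,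
      Finset.sum_sub_distrib, ← Finset.mul_sum]
    simp_rw [eW]
    ring
  rw [eD, abs_mul, abs_neg, abs_of_pos hb]
  have hterm : ∀ i, |∫ v, ∫ y, gaussGrad b v h' (a • y + a • v)
        ∂(P.map (fun ω => ∑ j ∈ Finset.univ.erase i, ξ j ω)) ∂(P.map (ξ i)) -
      a * ∫ v', ∫ v, ∫ y, gaussHess b v' h (a • y + a • v)
        ∂(P.map (fun ω => ∑ j ∈ Finset.univ.erase i, ξ j ω)) ∂(P.map (ξ i)) ∂(P.map (ξ i))| ≤
      2 * K * a ^ 2 * B * ∫ ω, ‖ξ i ω‖ ^ 2 ∂P := fun i => by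
    have h0 : ∫ v, v ∂(P.map (ξ i)) = 0 := by
      rw [integral_map (hm i).aemeasurable (by fun_prop)]
      exact X.integral_eq_zero i
    have := H.abs_integral_gaussGrad_sub_gaussHess_le ha hb hK0 (hK i) (X.ae_norm_le i) h0
    rwa [integral_map (f := fun v => ‖v‖ ^ 2) (hm i).aemeasurable (by fun_prop)] at this
  have hsum := (Finset.abs_sum_le_sum_abs _ Finset.univ).trans
    (Finset.sum_le_sum fun i _ => hterm i)
  rw [← Finset.mul_sum, X.sum_integral_norm_sq] at hsum
  calc _ ≤ b * (2 * K * a ^ 2 * B * Module.finrank ℝ E) := by gcongr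
    _ = _ := by ring

end HasBoundedFDeriv

end Interpolation

/-! ### The two estimates for smooth test functions. -/

section SmoothBounds

open scoped RealInnerProductSpace

set_option linter.unusedSectionVars false

variable {E : Type*} [NormedAddCommGroup E] [InnerProductSpace ℝ E] [FiniteDimensional ℝ E]
  [MeasurableSpace E] [BorelSpace E]

variable {Ω ι : Type*} [MeasurableSpace Ω] [Fintype ι] [DecidableEq ι] {P : Measure Ω}
  [IsProbabilityMeasure P] {ξ : ι → Ω → E} {B : ℝ}

theorem abs_sub_le_sub_of_deriv_le {F G F' G' : ℝ → ℝ} {s t : ℝ} (hst : s ≤ t)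
    (hF : ∀ x ∈ Set.Icc s t, HasDerivAt F (F' x) x) (hG : ∀ x ∈ Set.Icc s t, HasDerivAt G (G' x) x)
    (hle : ∀ x ∈ Set.Icc s t, |F' x| ≤ G' x) : |F t - F s| ≤ G t - G s :=
  image_norm_le_of_norm_deriv_right_le_deriv_boundary' (f := fun x => F x - F s)
    (B := fun x => G x - G s)
    (fun x hx => ((hF x hx).sub_const _).continuousAt.continuousWithinAt)
    (fun x hx => ((hF x ⟨hx.1, hx.2.le⟩).sub_const _).hasDerivWithinAt) (by simp)
    (fun x hx => ((hG x hx).sub_const _).continuousAt.continuousWithinAt)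
    (fun x hx => ((hG x ⟨hx.1, hx.2.le⟩).sub_const _).hasDerivWithinAt)
    (fun x hx => hle x ⟨hx.1, hx.2.le⟩) (Set.right_mem_Icc.2 hst)

/-- Every `1`-Lipschitz function is a uniform limit of continuously differentiable ones. -/
theorem exists_hasBoundedFDeriv_approx {f : E → ℝ} (hf : LipschitzWith 1 f) {ε : ℝ} (hε : 0 < ε) :
    ∃ h h', HasBoundedFDeriv h h' 1 ∧ ∀ x : E, |h x - f x| ≤ ε := by
  -- A mollifier supported within distance `ε` moves a `1`-Lipschitz function by at most `ε`.
  let φ : ContDiffBump (0 : E) := ⟨ε / 2, ε, by positivity, by linarith⟩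
  let h := convolution (φ.normed volume) f (ContinuousLinearMap.lsmul ℝ ℝ) volume
  have hφ : ContDiff ℝ 1 (φ.normed volume) := φ.contDiff_normed
  have hcd : ContDiff ℝ 1 h :=
    φ.hasCompactSupport_normed.contDiff_convolution_left (n := 1) _ hφ
      hf.continuous.locallyIntegrable
  have hex : ConvolutionExists (φ.normed volume) f (ContinuousLinearMap.lsmul ℝ ℝ) volume :=
    φ.hasCompactSupport_normed.convolutionExists_left _ φ.continuous_normed
      hf.continuous.locallyIntegrable
  have hlip : LipschitzWith 1 h := by
    refine LipschitzWith.of_dist_le_mul fun x y => ?_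
    rw [NNReal.coe_one, one_mul, Real.dist_eq]
    have e : h x - h y = ∫ t, φ.normed volume t • (f (x - t) - f (y - t)) := by
      simp only [h, convolution_def, ContinuousLinearMap.lsmul_apply, smul_sub]
      rw [integral_sub]
      · exact hex x
      · exact hex y
    have e2 : dist x y = ∫ t, φ.normed volume t * dist x y := by
      rw [integral_mul_const, φ.integral_normed, one_mul]
    rw [e, e2, ← Real.norm_eq_abs]
    refine norm_integral_le_of_norm_le (φ.integrable_normed.mul_const _) (.of_forall fun t => ?_)
    rw [norm_smul, Real.norm_of_nonneg (φ.nonneg_normed t)]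
    refine mul_le_mul_of_nonneg_left ?_ (φ.nonneg_normed t)
    simpa [Real.dist_eq] using hf.dist_le_mul (x - t) (y - t)
  refine ⟨h, fderiv ℝ h, ⟨fun x => (hcd.differentiable one_ne_zero x).hasFDerivAt,
    hcd.continuous_fderiv one_ne_zero, fun x => ?_⟩, fun x => ?_⟩
  · simpa using norm_fderiv_le_of_lipschitz ℝ hlip (x₀ := x)
  · rw [← Real.dist_eq]
    refine φ.dist_normed_convolution_le hf.continuous.aestronglyMeasurable fun y hy => ?_
    refine (hf.dist_le_mul y x).trans ?_
    rw [NNReal.coe_one, one_mul]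
    exact (Metric.mem_ball.1 hy).le

theorem integrable_lipschitz {Ω : Type*} [MeasurableSpace Ω] {P : Measure Ω}
    [IsProbabilityMeasure P] {f : E → ℝ} {L : ℝ} (hL : 0 ≤ L)
    (hf : ∀ x y, |f x - f y| ≤ L * ‖x - y‖) {Y : Ω → E} (hY : Integrable Y P) :
    Integrable (fun ω => f (Y ω)) P := by
  refine ((integrable_const |f 0|).add (hY.norm.const_mul L)).mono'
    ((LinearGrowth.of_lipschitz hL hf).1.comp_aestronglyMeasurable hY.aestronglyMeasurable)
    (.of_forall fun ω => ?_)
  have h1 := hf (Y ω) 0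
  have h2 := abs_add_le (f (Y ω) - f 0) (f 0)
  rw [sub_add_cancel] at h2
  rw [sub_zero] at h1
  simp only [Real.norm_eq_abs, Pi.add_apply]
  linarith

/-- The Wasserstein bound `δ` applied to Lipschitz functions with any constant. -/
theorem abs_integral_sub_le_mul {μ ν : Measure E} [IsProbabilityMeasure μ] [IsProbabilityMeasure ν]
    {δ : ℝ} (hδ : ∀ f, LipschitzWith 1 f → |∫ x, f x ∂μ - ∫ x, f x ∂ν| ≤ δ)
    {f : E → ℝ} {M : ℝ} (hM : 0 ≤ M) (hf : ∀ x y, |f x - f y| ≤ M * ‖x - y‖) :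
    |∫ x, f x ∂μ - ∫ x, f x ∂ν| ≤ M * δ := by
  rcases hM.eq_or_lt with rfl | hM
  · have : ∀ x, f x = f 0 := fun x => by
      have := hf x 0
      rw [zero_mul] at this
      linarith [abs_nonpos_iff.1 this]
    rw [funext this]
    simp
  · have h1 := hδ (fun x => M⁻¹ * f x) (LipschitzWith.of_dist_le_mul fun x y => by
      rw [Real.dist_eq, ← mul_sub, abs_mul, abs_of_pos (inv_pos.2 hM), NNReal.coe_one, one_mul,
        dist_eq_norm, inv_mul_le_iff₀ hM]
      exact hf x y)
    rw [integral_const_mul, integral_const_mul, ← mul_sub, abs_mul, abs_of_pos (inv_pos.2 hM),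
      inv_mul_le_iff₀ hM] at h1
    exact h1

namespace HasBoundedFDeriv

variable {h : E → ℝ} {h' : E → E →L[ℝ] ℝ} {L : ℝ}

theorem abs_integral_gaussHess_sub_le (H : HasBoundedFDeriv h h' L) {ρ : Measure E}
    [IsProbabilityMeasure ρ] (a : ℝ) {b : ℝ} (hb : 0 < b) (v w : E) :
    |∫ y, gaussHess b v h (a • y + w) ∂ρ - ∫ y, gaussHess b v h (a • y + 0) ∂ρ| ≤
      2 * L / b ^ 2 * ‖v‖ ^ 2 * ‖w‖ := by
  rw [← integral_sub (H.integrable_gaussHess a hb v w) (H.integrable_gaussHess a hb v 0)]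
  have := norm_integral_le_of_norm_le_const (μ := ρ) (C := 2 * L / b ^ 2 * ‖v‖ ^ 2 * ‖w‖)
    (f := fun y => gaussHess b v h (a • y + w) - gaussHess b v h (a • y + 0))
    (.of_forall fun y => by
      refine (abs_gaussHess_sub_le H.nonneg H.abs_sub_le b v _ _).trans (le_of_eq ?_)
      rw [add_zero, add_sub_cancel_left]
      ring)
  simpa using this

/-- At Gaussian arguments the second derivative of a smoothing is that of the full smoothing. -/
theorem abs_integral_gaussHess_stdGaussian_sub_le (H : HasBoundedFDeriv h h' L) {t : ℝ}
    (ht : 0 < Real.sin t) (v w : E) :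
    |∫ z, (gaussHess (Real.sin t) v h (Real.cos t • z + w) -
        gaussHess (Real.sin t) v h (Real.cos t • z)) ∂(stdGaussian E)| ≤
      2 * L * ‖v‖ ^ 2 * ‖w‖ := by
  have e : ∀ y, ∫ z, gaussHess (Real.sin t) v h (Real.cos t • z + y) ∂(stdGaussian E) =
      gaussHess 1 v h y := fun y => by
    simp_rw [add_comm _ y]
    rw [integral_gaussHess_add H.linearGrowth]
    -- The complementary angle makes `sin t` the differentiated scale and `cos t` the averaged one;
    -- together they give scale `1`.
    have := gaussHess_gaussSmooth H.linearGrowth one_ne_zero (θ := Real.pi / 2 - t)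
      (by rw [Real.cos_pi_div_two_sub]; exact ht.ne') v y
    rwa [Real.cos_pi_div_two_sub, Real.sin_pi_div_two_sub, one_mul, one_mul] at this
  have i0 := H.integrable_gaussHess (ρ := stdGaussian E) (Real.cos t) ht v 0
  have e0 := e 0
  simp only [add_zero] at i0 e0
  rw [integral_sub (H.integrable_gaussHess _ ht v w) i0, e, e0]
  refine (abs_gaussHess_sub_le H.nonneg H.abs_sub_le 1 v w 0).trans (le_of_eq ?_)
  simp

/-- The increment `κ` is Lipschitz with constant `Λ`. Restoring the missing summand costs `Λ * B`,
passing from `W` to the Gaussian costs `Λ * δ`, and the Gaussian mean of `κ` has no singularity in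
`sin t`. -/
theorem abs_integral_gaussHess_sub_le_of_wasserstein (H : HasBoundedFDeriv h h' L)
    (X : IsIsotropicFamily P ξ B) {δ : ℝ}
    (hδ : ∀ f, LipschitzWith 1 f →
      |∫ x, f x ∂(P.map fun ω => ∑ i, ξ i ω) - ∫ x, f x ∂(stdGaussian E)| ≤ δ)
    {t : ℝ} (ha : 0 ≤ Real.cos t) (hb : 0 < Real.sin t) (i : ι) (v w : E) :
    |∫ y, gaussHess (Real.sin t) v h (Real.cos t • y + w)
          ∂(P.map (fun ω => ∑ j ∈ Finset.univ.erase i, ξ j ω)) -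
        ∫ y, gaussHess (Real.sin t) v h (Real.cos t • y + 0)
          ∂(P.map (fun ω => ∑ j ∈ Finset.univ.erase i, ξ j ω))| ≤
      L * (2 + 6 * Real.cos t * (B + δ) / Real.sin t ^ 3) * ‖v‖ ^ 2 * ‖w‖ := by
  have hm := X.measurable
  have hL := H.nonneg
  set a := Real.cos t with hadef
  set b := Real.sin t with hbdef
  have hB := X.bound_nonneg i
  have hp1 : IsProbabilityMeasure (P.map (fun ω => ∑ j ∈ Finset.univ.erase i, ξ j ω)) :=
    Measure.isProbabilityMeasure_map (by fun_prop)
  have hp2 : IsProbabilityMeasure (P.map (fun ω => ∑ i, ξ i ω)) :=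
    Measure.isProbabilityMeasure_map (by fun_prop)
  set κ : E → ℝ := fun y => gaussHess b v h (a • y + w) - gaussHess b v h (a • y) with hκ
  set Λ : ℝ := 6 * L * ‖v‖ ^ 2 * ‖w‖ / b ^ 3 * a with hΛ
  have hΛ0 : 0 ≤ Λ := by positivity
  have hlip : ∀ x y, |κ x - κ y| ≤ Λ * ‖x - y‖ := fun x y => by
    refine (H.abs_gaussHess_add_sub_sub_le hb v w (a • x) (a • y)).trans (le_of_eq ?_)
    rw [← smul_sub, norm_smul, Real.norm_of_nonneg ha]
    ring
  have hκc : Continuous κ := (LinearGrowth.of_lipschitz hΛ0 hlip).1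
  have iR : Integrable (fun ω => ∑ j ∈ Finset.univ.erase i, ξ j ω) P :=
    integrable_finsetSum _ fun j _ => X.integrable j
  have i1 := H.integrable_gaussHess (ρ := P.map (fun ω => ∑ j ∈ Finset.univ.erase i, ξ j ω)) a hb v 0
  have e1 : ∫ y, gaussHess b v h (a • y + w)
          ∂(P.map (fun ω => ∑ j ∈ Finset.univ.erase i, ξ j ω)) -
        ∫ y, gaussHess b v h (a • y + 0)
          ∂(P.map (fun ω => ∑ j ∈ Finset.univ.erase i, ξ j ω)) =
      ∫ ω, κ (∑ j ∈ Finset.univ.erase i, ξ j ω) ∂P := by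
    rw [← integral_sub (H.integrable_gaussHess a hb v w) i1]
    simp_rw [add_zero]
    exact integral_map (by fun_prop) hκc.aestronglyMeasurable
  have b1 : |∫ ω, κ (∑ j ∈ Finset.univ.erase i, ξ j ω) ∂P - ∫ ω, κ (∑ j, ξ j ω) ∂P| ≤ Λ * B := by
    rw [← integral_sub (integrable_lipschitz hΛ0 hlip iR)
      (integrable_lipschitz hΛ0 hlip X.integrable_sum)]
    have := norm_integral_le_of_norm_le_const (μ := P) (C := Λ * B)
      (f := fun ω => κ (∑ j ∈ Finset.univ.erase i, ξ j ω) - κ (∑ j, ξ j ω)) (by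
        filter_upwards [X.norm_le i] with ω hω
        refine (hlip _ _).trans ?_
        rw [← Finset.sum_erase_add _ _ (Finset.mem_univ i), sub_add_cancel_left, norm_neg]
        gcongr)
    simpa using this
  have b2 : |∫ ω, κ (∑ j, ξ j ω) ∂P - ∫ z, κ z ∂(stdGaussian E)| ≤ Λ * δ := by
    have := abs_integral_sub_le_mul hδ hΛ0 hlip
    rwa [integral_map (by fun_prop) hκc.aestronglyMeasurable] at this
  have b3 : |∫ z, κ z ∂(stdGaussian E)| ≤ 2 * L * ‖v‖ ^ 2 * ‖w‖ :=
    H.abs_integral_gaussHess_stdGaussian_sub_le hb v w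
  rw [e1]
  have e2 : L * (2 + 6 * a * (B + δ) / b ^ 3) * ‖v‖ ^ 2 * ‖w‖ =
      Λ * B + Λ * δ + 2 * L * ‖v‖ ^ 2 * ‖w‖ := by
    rw [hΛ]
    ring
  rw [e2]
  rw [abs_le] at *
  constructor <;> linarith

/-- The interpolation stays close to its starting value, the law of the sum. -/
theorem abs_interpolation_sub_le (H : HasBoundedFDeriv h h' 1) (X : IsIsotropicFamily P ξ B)
    {t : ℝ} (ha : 0 ≤ Real.cos t) (hb : 0 ≤ Real.sin t) :
    |∫ p : Ω × E, h (Real.cos t • ∑ i, ξ i p.1 + Real.sin t • p.2) ∂(P.prod (stdGaussian E)) -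
      ∫ ω, h (∑ i, ξ i ω) ∂P| ≤ 2 * √(Module.finrank ℝ E) * Real.sin t := by
  have iW := X.integrable_sum
  have iW1 : Integrable (fun p : Ω × E => ∑ i, ξ i p.1) (P.prod (stdGaussian E)) := iW.comp_fst _
  have iZ1 : Integrable (fun p : Ω × E => p.2) (P.prod (stdGaussian E)) :=
    (IsGaussian.integrable_fun_id (μ := stdGaussian E)).comp_snd _
  have e1 : ∫ ω, h (∑ i, ξ i ω) ∂P =
      ∫ p : Ω × E, h (∑ i, ξ i p.1) ∂(P.prod (stdGaussian E)) := by
    rw [integral_fun_fst (fun ω => h (∑ i, ξ i ω))]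
    simp
  have hle1 : Real.cos t ≤ 1 := Real.cos_le_one t
  have hle : 1 - Real.cos t ≤ Real.sin t := by
    nlinarith [Real.sin_sq_add_cos_sq t, Real.sin_le_one t]
  have iI : Integrable (fun p : Ω × E => Real.cos t • ∑ i, ξ i p.1 + Real.sin t • p.2)
      (P.prod (stdGaussian E)) := (iW1.smul (Real.cos t)).add (iZ1.smul (Real.sin t))
  rw [e1, ← integral_sub (integrable_lipschitz zero_le_one H.abs_sub_le iI)
    (integrable_lipschitz zero_le_one H.abs_sub_le iW1), ← Real.norm_eq_abs]
  refine (norm_integral_le_of_norm_le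
    ((iW1.norm.const_mul (Real.sin t)).add (iZ1.norm.const_mul (Real.sin t)))
    (.of_forall fun p => ?_)).trans ?_
  · refine (H.abs_sub_le _ _).trans ?_
    rw [one_mul]
    have e2 : Real.cos t • ∑ i, ξ i p.1 + Real.sin t • p.2 - ∑ i, ξ i p.1 =
        Real.sin t • p.2 - (1 - Real.cos t) • ∑ i, ξ i p.1 := by module
    simp only [Pi.add_apply]
    rw [e2]
    refine (norm_sub_le _ _).trans ?_
    rw [norm_smul, norm_smul, Real.norm_of_nonneg hb, Real.norm_of_nonneg (by linarith), add_comm]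
    gcongr
  · have e3 : ∫ p : Ω × E, ‖∑ i, ξ i p.1‖ ∂(P.prod (stdGaussian E)) = ∫ ω, ‖∑ i, ξ i ω‖ ∂P := by
      rw [integral_fun_fst (fun ω => ‖∑ i, ξ i ω‖)]
      simp
    have e4 : ∫ p : Ω × E, ‖p.2‖ ∂(P.prod (stdGaussian E)) = ∫ z, ‖z‖ ∂(stdGaussian E) := by
      rw [integral_fun_snd (fun z => ‖z‖)]
      simp
    simp only [Pi.add_apply]
    rw [integral_add (iW1.norm.const_mul _) (iZ1.norm.const_mul _), integral_const_mul,
      integral_const_mul, e3, e4]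
    nlinarith [X.integral_norm_sum_le, integral_norm_stdGaussian_le (E := E)]

/-- The derivative bound may blow up at `t = 0`, so it is integrated only from `arcsin s` to `π /
2`. `G` is an antiderivative of a majorant, in the variable `sin t`; the initial piece is estimated
directly. -/
theorem abs_integral_sub_le_of_deriv (H : HasBoundedFDeriv h h' 1)
    (X : IsIsotropicFamily P ξ B) {s : ℝ} (hs0 : 0 < s) (hs1 : s ≤ 1) {K G : ℝ → ℝ}
    (hK0 : ∀ t, 0 ≤ Real.cos t → 0 < Real.sin t → 0 ≤ K t)
    (hK : ∀ t, 0 ≤ Real.cos t → 0 < Real.sin t → ∀ i v w,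
      |∫ y, gaussHess (Real.sin t) v h (Real.cos t • y + w)
          ∂(P.map (fun ω => ∑ j ∈ Finset.univ.erase i, ξ j ω)) -
        ∫ y, gaussHess (Real.sin t) v h (Real.cos t • y + 0)
          ∂(P.map (fun ω => ∑ j ∈ Finset.univ.erase i, ξ j ω))| ≤ K t * ‖v‖ ^ 2 * ‖w‖)
    (hG : ∀ t, 0 ≤ Real.cos t → 0 < Real.sin t → ∃ G', HasDerivAt (fun t => G (Real.sin t)) G' t ∧
      2 * K t * Real.cos t ^ 2 * Real.sin t * B * Module.finrank ℝ E ≤ G') :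
    |∫ ω, h (∑ i, ξ i ω) ∂P - ∫ z, h z ∂(stdGaussian E)| ≤
      2 * √(Module.finrank ℝ E) * s + (G 1 - G s) := by
  set t₀ := Real.arcsin s
  have hsin : Real.sin t₀ = s := Real.sin_arcsin (by linarith) hs1
  have ht0 : 0 < t₀ := Real.arcsin_pos.2 hs0
  have ht1 : t₀ ≤ Real.pi / 2 := Real.arcsin_le_pi_div_two s
  have hcos : ∀ t ∈ Set.Icc t₀ (Real.pi / 2), 0 ≤ Real.cos t := fun t ht =>
    Real.cos_nonneg_of_neg_pi_div_two_le_of_le (by linarith [ht.1, Real.pi_pos]) ht.2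
  have hsinp : ∀ t ∈ Set.Icc t₀ (Real.pi / 2), 0 < Real.sin t := fun t ht =>
    Real.sin_pos_of_pos_of_lt_pi (by linarith [ht.1]) (by linarith [ht.2, Real.pi_pos])
  -- The implication allows dummy values off the interval, so `D` and `G'` can be chosen as
  -- functions on all of `ℝ`.
  have hex : ∀ t, ∃ D G', t ∈ Set.Icc t₀ (Real.pi / 2) →
      HasDerivAt (fun t : ℝ => ∫ p : Ω × E, h (Real.cos t • ∑ i, ξ i p.1 + Real.sin t • p.2)
        ∂(P.prod (stdGaussian E))) D t ∧ HasDerivAt (fun t => G (Real.sin t)) G' t ∧ |D| ≤ G' := by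
    intro t
    by_cases ht : t ∈ Set.Icc t₀ (Real.pi / 2)
    · have h1 := hcos t ht
      have h2 := hsinp t ht
      obtain ⟨D, hD, hDle⟩ := H.exists_hasDerivAt_interpolation X h1 h2 (hK0 t h1 h2) (hK t h1 h2)
      obtain ⟨G', hG', hle⟩ := hG t h1 h2
      exact ⟨D, G', fun _ => ⟨hD, hG', hDle.trans hle⟩⟩
    · exact ⟨0, 0, fun h => absurd h ht⟩
  choose D G' hDG using hex
  have key := abs_sub_le_sub_of_deriv_le ht1 (fun t ht => (hDG t ht).1) (fun t ht => (hDG t ht).2.1)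
    (fun t ht => (hDG t ht).2.2)
  have hend := H.abs_interpolation_sub_le X (t := t₀) (hcos t₀ ⟨le_rfl, ht1⟩)
    (hsinp t₀ ⟨le_rfl, ht1⟩).le
  have e1 : ∫ p : Ω × E, h (Real.cos (Real.pi / 2) • ∑ i, ξ i p.1 + Real.sin (Real.pi / 2) • p.2)
      ∂(P.prod (stdGaussian E)) = ∫ z, h z ∂(stdGaussian E) := by
    simp only [Real.cos_pi_div_two, Real.sin_pi_div_two, zero_smul, one_smul, zero_add]
    rw [integral_fun_snd h]
    simp
  rw [e1, Real.sin_pi_div_two, hsin] at key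
  rw [hsin] at hend
  rw [abs_le] at *
  constructor <;> linarith

/-- The logarithmic bound for smooth test functions. -/
theorem abs_integral_sub_le_log (H : HasBoundedFDeriv h h' 1) (X : IsIsotropicFamily P ξ B)
    (hB : 0 ≤ B) {s : ℝ} (hs0 : 0 < s) (hs1 : s ≤ 1) :
    |∫ ω, h (∑ i, ξ i ω) ∂P - ∫ z, h z ∂(stdGaussian E)| ≤
      2 * √(Module.finrank ℝ E) * s - 4 * B * Module.finrank ℝ E * Real.log s := by
  have hm := X.measurable
  have hp1 : ∀ i, IsProbabilityMeasure (P.map (fun ω => ∑ j ∈ Finset.univ.erase i, ξ j ω)) :=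
    fun i => Measure.isProbabilityMeasure_map (by fun_prop)
  -- The derivative bound is `4 B d cos² t / sin t`; replacing `cos² t` by `cos t` makes it the
  -- derivative of `4 B d log (sin t)`.
  refine (H.abs_integral_sub_le_of_deriv X hs0 hs1 (K := fun t => 2 * 1 / Real.sin t ^ 2)
    (G := fun s => 4 * B * Module.finrank ℝ E * Real.log s) (fun t _ h2 => by positivity)
    (fun t _ h2 i v w => H.abs_integral_gaussHess_sub_le _ h2 v w)
    (fun t h1 h2 => ⟨_, ((Real.hasDerivAt_sin t).log h2.ne').const_mul _, ?_⟩)).trans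
    (le_of_eq (by simp; ring))
  have h3 := Real.cos_le_one t
  have e : 2 * (2 * 1 / Real.sin t ^ 2) * Real.cos t ^ 2 * Real.sin t * B * Module.finrank ℝ E =
      4 * B * Module.finrank ℝ E * (Real.cos t ^ 2 / Real.sin t) := by
    field_simp
    ring
  rw [e]
  gcongr
  nlinarith

/-- The self-improving bound for smooth test functions. -/
theorem abs_integral_sub_le_of_wasserstein (H : HasBoundedFDeriv h h' 1)
    (X : IsIsotropicFamily P ξ B) (hB : 0 ≤ B) {δ : ℝ} (hδ0 : 0 ≤ δ)
    (hδ : ∀ f, LipschitzWith 1 f →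
      |∫ x, f x ∂(P.map fun ω => ∑ i, ξ i ω) - ∫ x, f x ∂(stdGaussian E)| ≤ δ)
    {s : ℝ} (hs0 : 0 < s) (hs1 : s ≤ 1) :
    |∫ ω, h (∑ i, ξ i ω) ∂P - ∫ z, h z ∂(stdGaussian E)| ≤
      2 * √(Module.finrank ℝ E) * s + B * Module.finrank ℝ E * (4 + 12 * (B + δ) / s) := by
  refine (H.abs_integral_sub_le_of_deriv X hs0 hs1
    (K := fun t => 1 * (2 + 6 * Real.cos t * (B + δ) / Real.sin t ^ 3))
    (G := fun s => B * Module.finrank ℝ E * (4 * s - 12 * (B + δ) * s⁻¹))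
    (fun t h1 h2 => by positivity)
    (fun t h1 h2 i v w => H.abs_integral_gaussHess_sub_le_of_wasserstein X hδ h1 h2 i v w)
    (fun t h1 h2 => ⟨_, (((Real.hasDerivAt_sin t).const_mul 4).sub
      (((Real.hasDerivAt_sin t).inv h2.ne').const_mul (12 * (B + δ)))).const_mul _, ?_⟩)).trans ?_
  · have h3 := Real.cos_le_one t
    have h4 := Real.sin_le_one t
    have e : 2 * (1 * (2 + 6 * Real.cos t * (B + δ) / Real.sin t ^ 3)) * Real.cos t ^ 2 *
        Real.sin t * B * Module.finrank ℝ E = B * Module.finrank ℝ E *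
        (4 * (Real.cos t * (Real.cos t * Real.sin t)) +
          12 * (B + δ) * (Real.cos t * Real.cos t ^ 2 / Real.sin t ^ 2)) := by
      field_simp
      ring
    have e2 : 4 * Real.cos t - 12 * (B + δ) * (-Real.cos t / Real.sin t ^ 2) =
        4 * (Real.cos t * 1) + 12 * (B + δ) * (Real.cos t * 1 / Real.sin t ^ 2) := by ring
    rw [e, e2]
    have h5 : Real.cos t * Real.sin t ≤ 1 := mul_le_one₀ h3 h2.le h4
    have h6 : Real.cos t ^ 2 ≤ 1 := pow_le_one₀ h1 h3
    gcongr
  -- The negative contributions to `G 1 - G s` are dropped.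
  · have h7 : 0 ≤ B * Module.finrank ℝ E * (12 * (B + δ)) := by positivity
    have h8 : 0 ≤ B * Module.finrank ℝ E * (4 * s) := by positivity
    have : 12 * (B + δ) / s = 12 * (B + δ) * s⁻¹ := by ring
    rw [this]
    simp only [inv_one, mul_one]
    nlinarith

end HasBoundedFDeriv

end SmoothBounds

/-! ### Passage to the Wasserstein distance and to normalized sums. -/

section Final

open scoped RealInnerProductSpace

theorem abs_integral_comp_sub_le_of_approx {E Ω : Type*} [NormedAddCommGroup E]
    [InnerProductSpace ℝ E] [FiniteDimensional ℝ E] [MeasurableSpace E] [BorelSpace E]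
    [MeasurableSpace Ω] {P : Measure Ω}
    [IsProbabilityMeasure P] {h f : E → ℝ} {h' : E → E →L[ℝ] ℝ} {ε : ℝ}
    (H : HasBoundedFDeriv h h' 1) (hf : ∀ x y, |f x - f y| ≤ 1 * ‖x - y‖)
    (hfh : ∀ x, |h x - f x| ≤ ε) {Y : Ω → E} (hY : Integrable Y P) :
    |∫ ω, h (Y ω) ∂P - ∫ ω, f (Y ω) ∂P| ≤ ε := by
  rw [← integral_sub (integrable_lipschitz zero_le_one H.abs_sub_le hY)
    (integrable_lipschitz zero_le_one hf hY)]
  simpa using norm_integral_le_of_norm_le_const (μ := P) (C := ε)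
    (f := fun ω => h (Y ω) - f (Y ω)) (.of_forall fun ω => hfh (Y ω))

theorem abs_integral_map_sub_le_of_smooth {E Ω : Type*} [NormedAddCommGroup E]
    [InnerProductSpace ℝ E] [FiniteDimensional ℝ E] [MeasurableSpace E] [BorelSpace E]
    [MeasurableSpace Ω] {P : Measure Ω} [IsProbabilityMeasure P] {W : Ω → E} (hW : Integrable W P)
    {c : ℝ} (hc : ∀ h h', HasBoundedFDeriv h h' 1 →
      |∫ ω, h (W ω) ∂P - ∫ z, h z ∂(stdGaussian E)| ≤ c)
    {f : E → ℝ} (hf : LipschitzWith 1 f) :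
    |∫ x, f x ∂(P.map W) - ∫ z, f z ∂(stdGaussian E)| ≤ c := by
  rw [integral_map hW.aemeasurable hf.continuous.aestronglyMeasurable]
  refine le_of_forall_pos_le_add fun ε hε => ?_
  obtain ⟨h, h', H, hfh⟩ := exists_hasBoundedFDeriv_approx hf (half_pos hε)
  have hf' : ∀ x y, |f x - f y| ≤ 1 * ‖x - y‖ := fun x y => by
    simpa [Real.dist_eq, dist_eq_norm] using hf.dist_le_mul x y
  have h1 := abs_integral_comp_sub_le_of_approx H hf' hfh hW
  have h2 := abs_integral_comp_sub_le_of_approx H hf' hfh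
    (IsGaussian.integrable_fun_id (μ := stdGaussian E))
  have h3 := hc h h' H
  rw [abs_le] at *
  constructor <;> linarith

theorem wassersteinDist_le_ofReal {d : ℕ} {μ ν : Measure (EuclideanSpace ℝ (Fin d))} {c : ℝ}
    (h : ∀ f, LipschitzWith 1 f → |∫ x, f x ∂μ - ∫ x, f x ∂ν| ≤ c) :
    wassersteinDist μ ν ≤ ENNReal.ofReal c :=
  iSup₂_le fun f hf => ENNReal.ofReal_le_ofReal (h f hf)

theorem abs_integral_sub_le_toReal_wassersteinDist {d : ℕ}
    {μ ν : Measure (EuclideanSpace ℝ (Fin d))} (hfin : wassersteinDist μ ν ≠ ∞)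
    (f : EuclideanSpace ℝ (Fin d) → ℝ) (hf : LipschitzWith 1 f) :
    |∫ x, f x ∂μ - ∫ x, f x ∂ν| ≤ (wassersteinDist μ ν).toReal := by
  refine (ENNReal.ofReal_le_iff_le_toReal hfin).1 ?_
  unfold wassersteinDist
  exact le_iSup₂ (f := fun (h : EuclideanSpace ℝ (Fin d) → ℝ) (_ : LipschitzWith 1 h) =>
    ENNReal.ofReal |∫ x, h x ∂μ - ∫ x, h x ∂ν|) f hf

namespace IsIsotropicFamily

variable {Ω ι : Type*} [MeasurableSpace Ω] [Fintype ι] [DecidableEq ι] {P : Measure Ω}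
  [IsProbabilityMeasure P] {d : ℕ} {ξ : ι → Ω → EuclideanSpace ℝ (Fin d)} {B : ℝ}

theorem wassersteinDist_le_log (X : IsIsotropicFamily P ξ B) (hB : 0 ≤ B) {s : ℝ} (hs0 : 0 < s)
    (hs1 : s ≤ 1) :
    wassersteinDist (P.map fun ω => ∑ i, ξ i ω) (stdGaussian (EuclideanSpace ℝ (Fin d))) ≤
      ENNReal.ofReal (2 * √d * s - 4 * B * d * Real.log s) :=
  wassersteinDist_le_ofReal fun f hf =>
    abs_integral_map_sub_le_of_smooth X.integrable_sum (fun h h' H => by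
      simpa using H.abs_integral_sub_le_log X hB hs0 hs1) hf

theorem wassersteinDist_le_dim_sq (X : IsIsotropicFamily P ξ B) (hB : 0 < B) (hd : 1 ≤ d) :
    wassersteinDist (P.map fun ω => ∑ i, ξ i ω) (stdGaussian (EuclideanSpace ℝ (Fin d))) ≤
      ENNReal.ofReal (105 * d ^ 2 * B) := by
  have hd1 : (1 : ℝ) ≤ d := by exact_mod_cast hd
  have hsq : √(d : ℝ) ≤ d := by
    rw [Real.sqrt_le_left (by linarith)]
    nlinarith
  -- At `s = 1` the logarithm vanishes, leaving the a priori bound `2 √d`. It makes the distance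
  -- finite, which absorbing `δ / 2` requires.
  have htriv := X.wassersteinDist_le_log hB.le one_pos le_rfl
  simp only [Real.log_one, mul_zero, sub_zero, mul_one] at htriv
  have hfin := ne_top_of_le_ne_top ENNReal.ofReal_ne_top htriv
  -- The choice `s = 24 B d` makes the coefficient of `δ` equal to `1 / 2`. If it exceeds `1`, the a
  -- priori bound already suffices.
  rcases le_total (24 * B * d) 1 with hs | hs
  · set δ := (wassersteinDist (P.map fun ω => ∑ i, ξ i ω)
      (stdGaussian (EuclideanSpace ℝ (Fin d)))).toReal with hδdef
    have hδ := abs_integral_sub_le_toReal_wassersteinDist hfin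
    have hδ0 : 0 ≤ δ := ENNReal.toReal_nonneg
    have hspos : 0 < 24 * B * d := by positivity
    have hle := wassersteinDist_le_ofReal fun f hf =>
      abs_integral_map_sub_le_of_smooth X.integrable_sum (fun h h' H => by
        simpa using H.abs_integral_sub_le_of_wasserstein X hB.le hδ0 hδ hspos hs) hf
    have e : B * d * (4 + 12 * (B + δ) / (24 * B * d)) = 4 * (B * d) + (B + δ) / 2 := by
      field_simp
      ring
    rw [e] at hle
    have h1 := ENNReal.toReal_le_of_le_ofReal (by positivity) hle
    rw [← hδdef] at h1
    rw [← ENNReal.ofReal_toReal hfin, ← hδdef]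
    refine ENNReal.ofReal_le_ofReal ?_
    -- Solving for `δ` gives `δ ≤ 96 √d B d + 8 B d + B`, and `96 + 8 + 1 = 105`.
    have h2 : √(d : ℝ) * (B * d) ≤ d * (B * d) := by gcongr
    have h3 : B * 1 ≤ B * d := by gcongr
    have h4 : B * d * 1 ≤ B * d * d := by gcongr
    nlinarith
  · refine htriv.trans (ENNReal.ofReal_le_ofReal ?_)
    have h2 : √(d : ℝ) * 1 ≤ d * (24 * B * d) := by gcongr
    have h3 : 0 ≤ d ^ 2 * B := by positivity
    nlinarith

end IsIsotropicFamily

theorem normalizedSum_eq_sum_smul {Ω : Type*} {d n : ℕ} {X : Fin n → Ω → EuclideanSpace ℝ (Fin d)} :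
    normalizedSum X = fun ω => ∑ i, (√(n : ℝ))⁻¹ • X i ω := by
  ext1 ω
  rw [normalizedSum, Finset.smul_sum]

variable {Ω : Type*} [MeasurableSpace Ω] {P : Measure Ω} [IsProbabilityMeasure P] {d n : ℕ}
  {X : Fin n → Ω → EuclideanSpace ℝ (Fin d)} {β : ℝ}

theorem isIsotropicFamily_smul (hm : ∀ i, Measurable (X i)) (hind : iIndepFun X P)
    (h0 : ∀ i, ∫ ω, X i ω ∂P = 0) (hβ : ∀ i, ∀ᵐ ω ∂P, ‖X i ω‖ ≤ β)
    (hcov : secondMomentMatrix P (normalizedSum X) = 1) :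
    IsIsotropicFamily P (fun i ω => (√(n : ℝ))⁻¹ • X i ω) (β / √(n : ℝ)) where
  measurable i := (hm i).const_smul (√(n : ℝ))⁻¹
  iIndepFun := hind.comp (fun _ x => (√(n : ℝ))⁻¹ • x) fun _ => by fun_prop
  integral_eq_zero i := by rw [integral_smul, h0, smul_zero]
  norm_le i := by
    filter_upwards [hβ i] with ω hω
    rw [norm_smul, norm_inv, Real.norm_of_nonneg (Real.sqrt_nonneg _), div_eq_inv_mul]
    gcongr
  covariance u v := by
    have hW : normalizedSum X = fun ω => ∑ i, (√(n : ℝ))⁻¹ • X i ω := normalizedSum_eq_sum_smul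
    have hL : MemLp (normalizedSum X) 2 P := by
      rw [hW]
      exact memLp_finsetSum _ fun i _ =>
        (MemLp.of_bound (hm i).aestronglyMeasurable β (hβ i)).const_smul (√(n : ℝ))⁻¹
    have hLj : ∀ j, MemLp (fun ω => normalizedSum X ω j) 2 P := fun j =>
      (EuclideanSpace.proj (𝕜 := ℝ) j).comp_memLp' hL
    have hint : ∀ j k, Integrable (fun ω => normalizedSum X ω j * normalizedSum X ω k) P :=
      fun j k => (hLj j).integrable_mul (hLj k)
    have hjk : ∀ j k, ∫ ω, normalizedSum X ω j * normalizedSum X ω k ∂P =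
        (1 : Matrix (Fin d) (Fin d) ℝ) j k := fun j k => by
      rw [← hcov]
      rfl
    have e : ∀ ω, ⟪u, ∑ i, (√(n : ℝ))⁻¹ • X i ω⟫ * ⟪v, ∑ i, (√(n : ℝ))⁻¹ • X i ω⟫ =
        ∑ j, ∑ k, (u j * v k) * (normalizedSum X ω j * normalizedSum X ω k) := fun ω => by
      rw [← congrFun hW ω]
      simp only [PiLp.inner_apply, RCLike.inner_apply, conj_trivial]
      rw [Finset.sum_mul_sum]
      refine Finset.sum_congr rfl fun j _ => Finset.sum_congr rfl fun k _ => by ring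
    simp_rw [e]
    rw [integral_finsetSum _ fun j _ => integrable_finsetSum _ fun k _ => (hint j k).const_mul _]
    simp_rw [integral_finsetSum _ fun k _ => (hint _ k).const_mul _, integral_const_mul, hjk,
      Matrix.one_apply]
    simp [PiLp.inner_apply, mul_comm]

end Final

theorem theoremB1 :
    ∃ C : ℝ, 0 < C ∧
      ∀ (d n : ℕ), 1 ≤ d → 1 ≤ n →
      ∀ (Ω : Type*) [MeasurableSpace Ω] (P : Measure Ω) [IsProbabilityMeasure P]
        (X : Fin n → Ω → EuclideanSpace ℝ (Fin d)) (β : ℝ),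
        (∀ i, Measurable (X i)) →
        iIndepFun X P →
        (∀ i, ∫ ω, X i ω ∂P = 0) →
        (∀ i, ∀ᵐ ω ∂P, ‖X i ω‖ ≤ β) →
        secondMomentMatrix P (normalizedSum X) = 1 →
        wassersteinDist (P.map (normalizedSum X)) (stdGaussian (EuclideanSpace ℝ (Fin d)))
            ≤ ENNReal.ofReal (C * d * β / √(n : ℝ) * (1 + Real.log n)) ∧
        wassersteinDist (P.map (normalizedSum X)) (stdGaussian (EuclideanSpace ℝ (Fin d)))
            ≤ ENNReal.ofReal (C * (d : ℝ) ^ 2 * β / √(n : ℝ)) := by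
  refine ⟨105, by norm_num, fun d n hd hn Ω _ P _ X β hm hind h0 hβ hcov => ?_⟩
  have I := isIsotropicFamily_smul hm hind h0 hβ hcov
  have hd1 : (1 : ℝ) ≤ d := by exact_mod_cast hd
  have hn1 : (1 : ℝ) ≤ n := by exact_mod_cast hn
  have hs1 : 1 ≤ √(n : ℝ) := Real.one_le_sqrt.2 hn1
  have hs0 : 0 < √(n : ℝ) := by linarith
  have hβ0 : 0 ≤ β := by
    obtain ⟨ω, hω⟩ := (hβ ⟨0, hn⟩).exists
    exact (norm_nonneg _).trans hω
  -- Taking the trace of the covariance, `d = ∑ E ‖ξ_i‖² ≤ n (β / √n)²`. So `β ≥ √d ≥ 1`, which lets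
  -- the term `2 √d / √n` be absorbed into `d β / √n`.
  have hdβ : (d : ℝ) ≤ β ^ 2 := by
    have h1 := I.sum_integral_norm_sq
    rw [finrank_euclideanSpace_fin] at h1
    have h2 : ∀ i, ∫ ω, ‖(√(n : ℝ))⁻¹ • X i ω‖ ^ 2 ∂P ≤ (β / √(n : ℝ)) ^ 2 := fun i => by
      have h3 : ∫ ω, ‖(√(n : ℝ))⁻¹ • X i ω‖ ^ 2 ∂P ≤ ∫ _, (β / √(n : ℝ)) ^ 2 ∂P := by
        refine integral_mono_ae (I.integrable_norm_sq i) (integrable_const _) ?_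
        filter_upwards [I.norm_le i] with ω hω
        gcongr
      simpa using h3
    have h4 := Finset.sum_le_sum fun i (_ : i ∈ Finset.univ) => h2 i
    rw [h1, Finset.sum_const, Finset.card_univ, Fintype.card_fin, nsmul_eq_mul, div_pow,
      Real.sq_sqrt (by linarith), mul_div_cancel₀ _ (by linarith)] at h4
    exact h4
  have hβ1 : 1 ≤ β := by nlinarith
  have hsd : √(d : ℝ) ≤ β := Real.sqrt_le_iff.2 ⟨hβ0, hdβ⟩
  rw [normalizedSum_eq_sum_smul]
  constructor
  -- Here `s = 1 / √n`, so `-log s = (log n) / 2`.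
  · refine (I.wassersteinDist_le_log (by positivity) (inv_pos.2 hs0)
      (inv_le_one_of_one_le₀ hs1)).trans (ENNReal.ofReal_le_ofReal ?_)
    have hlog : 0 ≤ Real.log n := Real.log_nonneg hn1
    rw [Real.log_inv, Real.log_sqrt (by linarith)]
    have h1 : 2 * √(d : ℝ) * (√(n : ℝ))⁻¹ ≤ 2 * (d * β) * (√(n : ℝ))⁻¹ := by
      gcongr
      nlinarith
    have h2 : 0 ≤ d * β * (√(n : ℝ))⁻¹ := by positivity
    have h3 : 0 ≤ d * β * (√(n : ℝ))⁻¹ * Real.log n := by positivity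
    have e1 : 4 * (β / √(n : ℝ)) * d * -(Real.log n / 2) =
        -(2 * (d * β * (√(n : ℝ))⁻¹ * Real.log n)) := by ring
    have e2 : 105 * d * β / √(n : ℝ) * (1 + Real.log n) =
        105 * (d * β * (√(n : ℝ))⁻¹) + 105 * (d * β * (√(n : ℝ))⁻¹ * Real.log n) := by ring
    rw [e1, e2]
    nlinarith
  · refine (I.wassersteinDist_le_dim_sq (by positivity) hd).trans (le_of_eq ?_)
    congr 1
    ring
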